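/- Let $(\Omega,\mathcal F,P)$ be a probability space, $\Omega_X\subseteq\mathbb R^p$, $\Omega_Y\subseteq\mathbb R^q$, let $X:\Omega\to\Omega_X$ and $Y:\Omega\to\Omega_Y$ be random vectors, and let $(X_1,Y_1),(X_2,Y_2),\dots$ be i.i.d. copies of $(X,Y)$. Let $\kappa_X,\kappa_Y$ be bounded continuous positive semidefinite kernels on $\Omega_X$, $\Omega_Y$ with reproducing kernel Hilbert spaces $\mathcal H_X,\mathcal H_Y$. Assume that $\mathcal H_X$ is dense in $L_2(P_X)$ modulo constants, that is, for every $f\in L_2(P_X)$ there are $f_m\in\mathcal H_X$ with $\mathrm{var}[f_m(X)-f(X)]\to0$, and likewise $\mathcal H_Y$ in $L_2(P_Y)$. Write $(a\otimes b)c=\langle b,c\rangle a$, $\mu_X=E\,\kappa_X(\cdot,X)$, $\mu_Y=E\,\kappa_Y(\cdot,Y)$, and $$\Sigma_{XX}=E[(\kappa_X(\cdot,X)-\mu_X)\otimes(\kappa_X(\cdot,X)-\mu_X)],\qquad \Sigma_{XY}=E[(\kappa_X(\cdot,X)-\mu_X)\otimes(\kappa_Y(\cdot,Y)-\mu_Y)]:\mathcal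 H_Y\to\mathcal H_X .$$ For a bounded operator $A$ let $A^\dagger:\mathrm{ran}(A)\to\ker(A)^\perp$ be its Moore--Penrose inverse, the inverse of $A|_{\ker(A)^\perp}$. Assume that $\mathrm{ran}(\Sigma_{XY})\subseteq\mathrm{ran}(\Sigma_{XX})$ and that the regression operator $R_{XY}=\Sigma_{XX}^\dagger\Sigma_{XY}$ is bounded. Assume that $\Sigma_{XX}=\sum_{j\ge1}\lambda_j\,\varphi_j\otimes\varphi_j$ with $(\varphi_j)$ orthonormal, $\lambda_1\ge\lambda_2\ge\cdots$, and $\lambda_j\asymp j^{-\alpha}$ for all $j\ge1$, where $\alpha>1$; and that for some $\beta>0$ there is a bounded linear operator $S_{XY}:\mathcal H_Y\to\mathcal H_X$ with $\Sigma_{XY}=\Sigma_{XX}^{1+\beta}S_{XY}$, where $\Sigma_{XX}^{1+\beta}=\sum_j\lambda_j^{1+\beta}\varphi_j\otimes\varphi_j$. Let $\epsilon_n>0$, $\epsilon_n\to0$, and put $\widehat R_{XY}=(\widehat\Sigma_{XX}+\epsilon_nI)^{-1}\widehat\Sigma_{XY}$, where $$\widehat\Sigma_{XX}=\frac1n\sum_{i=1}^n(\kappa_X(\cdot,X_i)-\widehat\mu_X)\otimes(\kappa_X(\cdot,X_i)-\widehat\mu_X),\qquad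 \widehat\Sigma_{XY}=\frac1n\sum_{i=1}^n(\kappa_X(\cdot,X_i)-\widehat\mu_X)\otimes(\kappa_Y(\cdot,Y_i)-\widehat\mu_Y),$$ and $\widehat\mu_X=\frac1n\sum_{i=1}^n\kappa_X(\cdot,X_i)$, $\widehat\mu_Y=\frac1n\sum_{i=1}^n\kappa_Y(\cdot,Y_i)$. Then, as $n\to\infty$, in operator norm, $$\|\widehat R_{XY}-R_{XY}\|_{OP}=O_p\big(n^{-1/2}\epsilon_n^{(\beta\wedge1)-1}+\epsilon_n^{\beta\wedge1}+n^{-1}\epsilon_n^{-(3\alpha+1)/(2\alpha)}+n^{-1/2}\epsilon_n^{-(\alpha+1)/(2\alpha)}\big).$$ -/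

import Mathlib

open MeasureTheory ProbabilityTheory Filter Topology
open scoped ENNReal InnerProductSpace

namespace GSIR

noncomputable section

/-- Stochastic boundedness `Z n = O_p(r n)`. -/
def IsBigOp {Ω : Type*} [MeasurableSpace Ω] (P : Measure Ω) (Z : ℕ → Ω → ℝ) (r : ℕ → ℝ) : Prop :=
  ∀ δ : ℝ, 0 < δ → ∃ M : ℝ, ∀ᶠ n in atTop, P {ω | M * r n < |Z n ω|} ≤ ENNReal.ofReal δ

section Kernel

variable {𝒳 : Type*} (H : Type*) [NormedAddCommGroup H] [InnerProductSpace ℝ H] [CompleteSpace H]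
  [RKHS ℝ H 𝒳 ℝ]

/-- The scalar reproducing kernel `κ(x, y)` of a reproducing kernel Hilbert space `H`. -/
def kern (x y : 𝒳) : ℝ := RKHS.kernel H x y 1

/-- The element `κ(·, x)` of the reproducing kernel Hilbert space `H`. -/
def feature (x : 𝒳) : H := RKHS.kerFun H x 1

/-- The kernel of `H` is bounded and continuous (jointly in its two arguments). -/
def BoundedContinuousKernel [TopologicalSpace 𝒳] : Prop :=
  (∃ C : ℝ, ∀ x y : 𝒳, |kern H x y| ≤ C) ∧ Continuous fun z : 𝒳 × 𝒳 => kern H z.1 z.2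

/-- `H` is dense in `L₂(P_X)` modulo constants, `P_X` being the law of `X` under `P`. -/
def DenseModConstants {Ω : Type*} [MeasurableSpace Ω] [MeasurableSpace 𝒳] (P : Measure Ω)
    (X : Ω → 𝒳) : Prop :=
  ∀ f : 𝒳 → ℝ, Measurable f → MemLp f 2 (P.map X) →
    ∃ u : ℕ → H, Tendsto (fun n => Var[fun ω => u n (X ω) - f (X ω); P]) atTop (𝓝 0)

end Kernel

section Operators

variable {H₁ H₂ : Type*}
  [NormedAddCommGroup H₁] [InnerProductSpace ℝ H₁]
  [NormedAddCommGroup H₂] [InnerProductSpace ℝ H₂]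

/-- The (cross-)covariance operator `E[(Z - EZ) ⊗ (W - EW)] : H₂ → H₁`, where
`(a ⊗ b) c = ⟪b, c⟫ a`. -/
def crossCov {Ω : Type*} [MeasurableSpace Ω] (P : Measure Ω) (Z : Ω → H₁) (W : Ω → H₂) :
    H₂ →L[ℝ] H₁ :=
  ∫ ω, InnerProductSpace.rankOne ℝ (Z ω - ∫ ω', Z ω' ∂P) (W ω - ∫ ω', W ω' ∂P) ∂P

/-- The average of the first `n` terms of `z`. -/
def empMean {V : Type*} [AddCommGroup V] [Module ℝ V] (n : ℕ) (z : ℕ → V) : V :=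
  (n : ℝ)⁻¹ • ∑ i ∈ Finset.range n, z i

/-- The empirical (cross-)covariance operator of the first `n` observations. -/
def empCrossCov (n : ℕ) (z : ℕ → H₁) (w : ℕ → H₂) : H₂ →L[ℝ] H₁ :=
  empMean n fun i => InnerProductSpace.rankOne ℝ (z i - empMean n z) (w i - empMean n w)

/-- The restriction of `A` to `(ker A)ᗮ`, as a map onto the range of `A`. -/
def restrictKerOrthogonal (A : H₁ →L[ℝ] H₂) :
    (LinearMap.ker (A : H₁ →ₗ[ℝ] H₂))ᗮ →ₗ[ℝ] LinearMap.range (A : H₁ →ₗ[ℝ] H₂) :=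
  (A : H₁ →ₗ[ℝ] H₂).rangeRestrict ∘ₗ (LinearMap.ker (A : H₁ →ₗ[ℝ] H₂))ᗮ.subtype

theorem restrictKerOrthogonal_bijective [CompleteSpace H₁] (A : H₁ →L[ℝ] H₂) :
    Function.Bijective (restrictKerOrthogonal A) := by
  have hclosed : IsClosed ((LinearMap.ker (A : H₁ →ₗ[ℝ] H₂) : Submodule ℝ H₁) : Set H₁) :=
    A.isClosed_ker
  have : CompleteSpace (LinearMap.ker (A : H₁ →ₗ[ℝ] H₂)) := hclosed.completeSpace_coe
  constructor
  · rw [← LinearMap.ker_eq_bot, LinearMap.ker_eq_bot']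
    rintro ⟨x, hx⟩ h
    have hA : A x = 0 := congrArg Subtype.val h
    have hx' : x ∈ LinearMap.ker (A : H₁ →ₗ[ℝ] H₂) := hA
    have h0 : ⟪x, x⟫_ℝ = 0 := (Submodule.mem_orthogonal _ _).1 hx x hx'
    exact Subtype.ext (inner_self_eq_zero.1 h0)
  · rintro ⟨y, x, rfl⟩
    obtain ⟨u, hu, v, hv, rfl⟩ :=
      (LinearMap.ker (A : H₁ →ₗ[ℝ] H₂)).exists_add_mem_mem_orthogonal x
    refine ⟨⟨v, hv⟩, Subtype.ext ?_⟩
    have hu' : A u = 0 := hu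
    change A v = A (u + v)
    rw [map_add, hu', zero_add]

/-- The Moore-Penrose inverse `A† : ran A → (ker A)ᗮ`. -/
def moorePenrose [CompleteSpace H₁] (A : H₁ →L[ℝ] H₂) :
    LinearMap.range (A : H₁ →ₗ[ℝ] H₂) →ₗ[ℝ] (LinearMap.ker (A : H₁ →ₗ[ℝ] H₂))ᗮ :=
  (LinearEquiv.ofBijective (restrictKerOrthogonal A)
    (restrictKerOrthogonal_bijective A)).symm.toLinearMap

/-- The linear map `A† B`, defined when `ran B ⊆ ran A`. -/
def regressionMap [CompleteSpace H₁] (A : H₁ →L[ℝ] H₁) (B : H₂ →L[ℝ] H₁)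
    (h : LinearMap.range (B : H₂ →ₗ[ℝ] H₁) ≤ LinearMap.range (A : H₁ →ₗ[ℝ] H₁)) :
    H₂ →ₗ[ℝ] H₁ :=
  (LinearMap.ker (A : H₁ →ₗ[ℝ] H₁))ᗮ.subtype ∘ₗ moorePenrose A ∘ₗ
    (B : H₂ →ₗ[ℝ] H₁).codRestrict _ fun g => h (LinearMap.mem_range_self _ g)

/-- The Tikhonov regularized operator `(A + ε I)⁻¹ B`. -/
def tikhonov (A : H₁ →L[ℝ] H₁) (B : H₂ →L[ℝ] H₁) (ε : ℝ) : H₂ →L[ℝ] H₁ :=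
  Ring.inverse (A + ε • (1 : H₁ →L[ℝ] H₁)) ∘L B

/-- `(lam j, φ j)`, `j = 0, 1, …`, is the eigenvalue-eigenfunction sequence of `A`:
`lam` is nonincreasing, `φ` is orthonormal and `A = ∑ j, lam j • (φ j ⊗ φ j)`. -/
structure IsEigenSystem (A : H₁ →L[ℝ] H₁) (lam : ℕ → ℝ) (φ : ℕ → H₁) : Prop where
  antitone : Antitone lam
  orthonormal : Orthonormal ℝ φ
  hasSum : ∀ f : H₁, HasSum (fun j => lam j • ⟪φ j, f⟫_ℝ • φ j) (A f)

/-- `T` is the power of exponent `s > 0` of the nonnegative operator with eigenvalue-eigenfunction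
sequence `(lam j, φ j)`: `T = ∑ j, lam j ^ s • (φ j ⊗ φ j)`. -/
def IsSpectralPower (lam : ℕ → ℝ) (φ : ℕ → H₁) (s : ℝ) (T : H₁ →L[ℝ] H₁) : Prop :=
  ∀ f : H₁, HasSum (fun j => lam j ^ s • ⟪φ j, f⟫_ℝ • φ j) (T f)

end Operators

/-- `lam j ≍ j ^ (-α)` for `j = 1, 2, …`, with the sequence `lam` indexed from `0`. -/
def PolynomialDecay (lam : ℕ → ℝ) (α : ℝ) : Prop :=
  ∃ c C : ℝ, 0 < c ∧ 0 < C ∧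
    ∀ j : ℕ, c * ((j : ℝ) + 1) ^ (-α) ≤ lam j ∧ lam j ≤ C * ((j : ℝ) + 1) ^ (-α)

/-- The convergence rate as a function of `α`, `β`, the sample size `n` and `ε = ε_n`. -/
def rate (α β : ℝ) (n : ℕ) (ε : ℝ) : ℝ :=
  (n : ℝ) ^ (-(1 / 2) : ℝ) * ε ^ (min β 1 - 1) + ε ^ min β 1
    + (n : ℝ) ^ (-1 : ℝ) * ε ^ (-(3 * α + 1) / (2 * α))
    + (n : ℝ) ^ (-(1 / 2) : ℝ) * ε ^ (-(α + 1) / (2 * α))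

end

end GSIR

/-!
Let `Σ` and `Σ'` be the population and empirical covariance operators of the feature `a = κ_X(·, X)`,
let `b = κ_Y(·, Y)`, and put `G = (Σ + ε)⁻¹`. The regression residual `w = b - R* a` satisfies
`crossCov a w = Σ_XY - Σ R = 0`, and the empirical counterpart of this identity is
`empCrossCov a w = Σ'_XY - Σ' R`. The resolvent identity therefore gives
`R' - R = (1 + (Σ' + ε)⁻¹ (Σ - Σ')) (G (empCrossCov a w) - ε G R)`
for the estimator `R'` (`norm_tikhonov_sub_le`), and since `‖(Σ' + ε)⁻¹‖ ≤ ε⁻¹`,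
`‖R' - R‖ ≤ (1 + ε⁻¹ ‖Σ' - Σ‖) (‖empCrossCov (G a) w‖ + ε ‖G R‖)`.

* Bias. As `R` takes values in `(ker Σ)ᗮ`, the source condition says that `R = Σ ^ β S`, and
  diagonalizing `Σ` yields `‖G R‖ = O(ε ^ (β ∧ 1 - 1))`
  (`IsEigenSystem.norm_ringInverse_le_of_source`).
* Noise. Both random quantities are deviations of empirical cross-covariance operators from their
  population counterparts, the second of which is `0`. Their operator norms are dominated by the norms of
  i.i.d. sums in a Hilbert tensor product (the Hilbert–Schmidt norms), where Chebyshev's inequality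
  applies (`measure_lt_norm_empCrossCov_sub_le`): a deviation `‖empCrossCov u v - crossCov u v‖`
  with `v` bounded is `O_p (n ^ (-1/2) (E ‖u - E u‖²) ^ (1/2))`. For `u = a` this is `n ^ (-1/2)`.
  For `u = G a` the variance is `tr (G² Σ) = ∑ⱼ λⱼ / (λⱼ + ε)²`
  (`integral_norm_ringInverse_sq_le`), which polynomial decay of the eigenvalues bounds by a
  multiple of `ε ^ (-(α + 1) / α)` (`sum_div_add_sq_le`).

Multiplying out the product gives the four terms of the rate (`mul_le_mul_rate`).
-/

open MeasureTheory ProbabilityTheory Filter Topology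
open scoped ENNReal InnerProductSpace

namespace GSIR

/-! ### Chebyshev's inequality in Hilbert spaces -/

section WeakLaw

variable {Ω E K : Type*} [MeasurableSpace Ω] [MeasurableSpace E] {P : Measure Ω}
  [NormedAddCommGroup K]

theorem integrable_comp_of_norm_le [IsFiniteMeasure P] {Z : Ω → E} (hZ : AEMeasurable Z P)
    {f : E → K} (hf : StronglyMeasurable f) {C : ℝ} (hC : ∀ z, ‖f z‖ ≤ C) :
    Integrable (fun ω => f (Z ω)) P :=
  .of_bound (hf.aestronglyMeasurable.comp_aemeasurable hZ) C (ae_of_all _ fun _ => hC _)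

theorem integral_comp_eq_of_identDistrib [NormedSpace ℝ K] {Z Z' : Ω → E}
    (h : IdentDistrib Z Z' P P) {f : E → K} (hf : StronglyMeasurable f) :
    ∫ ω, f (Z ω) ∂P = ∫ ω, f (Z' ω) ∂P := by
  rw [← integral_map h.aemeasurable_fst hf.aestronglyMeasurable, h.map_eq,
    integral_map h.aemeasurable_snd hf.aestronglyMeasurable]

theorem integral_norm_sub_integral_sq_le [InnerProductSpace ℝ K] [CompleteSpace K]
    [IsProbabilityMeasure P] {Z : Ω → E} (hZ : AEMeasurable Z P) {f : E → K}
    (hf : StronglyMeasurable f) {C : ℝ} (hC : ∀ z, ‖f z‖ ≤ C) :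
    ∫ ω, ‖f (Z ω) - ∫ ω', f (Z ω') ∂P‖ ^ 2 ∂P ≤ ∫ ω, ‖f (Z ω)‖ ^ 2 ∂P := by
  set m := ∫ ω', f (Z ω') ∂P with hm
  have hi := integrable_comp_of_norm_le hZ hf hC
  have hi2 : Integrable (fun ω => ‖f (Z ω)‖ ^ 2) P :=
    integrable_comp_of_norm_le hZ (f := fun z => ‖f z‖ ^ 2) (hf.norm.pow 2) (C := C ^ 2) fun z => by
      rw [Real.norm_of_nonneg (by positivity)]
      exact pow_le_pow_left₀ (norm_nonneg _) (hC z) 2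
  have hin : Integrable (fun ω => ⟪m, f (Z ω)⟫_ℝ) P := hi.const_inner m
  have h1 : ∫ ω, ⟪m, f (Z ω)⟫_ℝ ∂P = ‖m‖ ^ 2 := by
    rw [integral_inner hi, ← hm, real_inner_self_eq_norm_sq]
  calc ∫ ω, ‖f (Z ω) - m‖ ^ 2 ∂P
      = ∫ ω, (‖f (Z ω)‖ ^ 2 - 2 * ⟪m, f (Z ω)⟫_ℝ + ‖m‖ ^ 2) ∂P := by
        congr 1; ext ω; rw [norm_sub_sq_real, real_inner_comm]
    _ = ∫ ω, ‖f (Z ω)‖ ^ 2 ∂P - ‖m‖ ^ 2 := by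
        rw [integral_add (f := fun ω => ‖f (Z ω)‖ ^ 2 - 2 * ⟪m, f (Z ω)⟫_ℝ)
          (hi2.sub (hin.const_mul 2)) (integrable_const _),
          integral_sub hi2 (hin.const_mul 2), integral_const_mul, h1]
        simp; ring
    _ ≤ _ := by nlinarith [sq_nonneg ‖m‖]

variable [InnerProductSpace ℝ K] [CompleteSpace K] [IsProbabilityMeasure P]
  {Z : Ω → E} {Zs : ℕ → Ω → E}

/-- The variance of a sum of independent copies of a bounded random element of a Hilbert space
is at most the sum of the variances: the cross terms vanish by independence. -/
theorem integral_norm_sum_sub_sq_le (hindep : iIndepFun Zs P)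
    (hident : ∀ i, IdentDistrib (Zs i) Z P P) {f : E → K} (hf : StronglyMeasurable f) {C : ℝ}
    (hC : ∀ z, ‖f z‖ ≤ C) (n : ℕ) :
    ∫ ω, ‖∑ i ∈ Finset.range n, (f (Zs i ω) - ∫ ω', f (Z ω') ∂P)‖ ^ 2 ∂P
      ≤ n * ∫ ω, ‖f (Z ω) - ∫ ω', f (Z ω') ∂P‖ ^ 2 ∂P := by
  set m := ∫ ω', f (Z ω') ∂P with hm
  set g : E → K := fun z => f z - m with hg
  have hgm : StronglyMeasurable g := hf.sub stronglyMeasurable_const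
  have hgC : ∀ z, ‖g z‖ ≤ C + ‖m‖ := fun z => (norm_sub_le _ _).trans (by gcongr; exact hC z)
  have hZs i := (hident i).aemeasurable_fst
  have hint i j : Integrable (fun ω => ⟪g (Zs i ω), g (Zs j ω)⟫_ℝ) P := by
    refine .of_bound (C := (C + ‖m‖) * (C + ‖m‖))
      ((hgm.aestronglyMeasurable.comp_aemeasurable (hZs i)).inner
        (hgm.aestronglyMeasurable.comp_aemeasurable (hZs j))) (ae_of_all _ fun ω => ?_)
    exact (norm_inner_le_norm _ _).trans (mul_le_mul (hgC _) (hgC _) (norm_nonneg _)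
      ((norm_nonneg _).trans (hgC (Zs i ω))))
  have hmean i : ∫ ω, g (Zs i ω) ∂P = 0 := by
    rw [integral_comp_eq_of_identDistrib (hident i) hgm,
      integral_sub (integrable_comp_of_norm_le (hident i).aemeasurable_snd hf hC)
        (integrable_const _)]
    simp [hm]
  have hoff i j (hij : i ≠ j) : ∫ ω, ⟪g (Zs i ω), g (Zs j ω)⟫_ℝ ∂P = 0 := by
    have hmi k : Integrable g (P.map (Zs k)) :=
      (integrable_map_measure hgm.aestronglyMeasurable (hZs k)).2
        (integrable_comp_of_norm_le (hZs k) hgm hgC)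
    have := (hindep.indepFun hij).integral_bilin_comp_comp (hZs i) (hZs j) (hmi i) (hmi j)
      (innerSL ℝ)
    rw [hmean, map_zero] at this
    exact this
  have hdiag i : ∫ ω, ⟪g (Zs i ω), g (Zs i ω)⟫_ℝ ∂P = ∫ ω, ‖g (Z ω)‖ ^ 2 ∂P := by
    simp_rw [real_inner_self_eq_norm_sq]
    exact integral_comp_eq_of_identDistrib (hident i) (f := fun z => ‖g z‖ ^ 2) (hgm.norm.pow 2)
  have hexp ω : ‖∑ i ∈ Finset.range n, g (Zs i ω)‖ ^ 2
      = ∑ i ∈ Finset.range n, ∑ j ∈ Finset.range n, ⟪g (Zs i ω), g (Zs j ω)⟫_ℝ := by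
    rw [← real_inner_self_eq_norm_sq, sum_inner]
    simp_rw [inner_sum]
  change ∫ ω, ‖∑ i ∈ Finset.range n, g (Zs i ω)‖ ^ 2 ∂P ≤ _
  simp_rw [hexp]
  rw [integral_finsetSum _ fun i _ => integrable_finsetSum _ fun j _ => hint i j]
  refine le_of_eq ?_
  calc _ = ∑ i ∈ Finset.range n, ∫ ω, ‖g (Z ω)‖ ^ 2 ∂P := by
        refine Finset.sum_congr rfl fun i hi => ?_
        rw [integral_finsetSum _ fun j _ => hint i j, Finset.sum_eq_single_of_mem i hi, hdiag]
        exact fun j _ hji => hoff i j hji.symm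
    _ = _ := by simp [hg]

/-- Chebyshev's inequality for the empirical mean of a bounded random element of a Hilbert
space. -/
theorem measure_lt_norm_empMean_sub_le (hindep : iIndepFun Zs P)
    (hident : ∀ i, IdentDistrib (Zs i) Z P P) {f : E → K} (hf : StronglyMeasurable f) {C : ℝ}
    (hC : ∀ z, ‖f z‖ ≤ C) {n : ℕ} (hn : 0 < n) {t V : ℝ} (ht : 0 < t)
    (hV : ∫ ω, ‖f (Z ω)‖ ^ 2 ∂P ≤ V) :
    P {ω | t < ‖empMean n (fun i => f (Zs i ω)) - ∫ ω', f (Z ω') ∂P‖}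
      ≤ ENNReal.ofReal (V / (n * t ^ 2)) := by
  have hZs i := (hident i).aemeasurable_fst
  set m := ∫ ω', f (Z ω') ∂P with hm
  have hn' : (0 : ℝ) < n := by exact_mod_cast hn
  set S : Ω → K := fun ω => ∑ i ∈ Finset.range n, (f (Zs i ω) - m) with hS
  have hemp ω : empMean n (fun i => f (Zs i ω)) - m = (n : ℝ)⁻¹ • S ω := by
    simp only [empMean, hS, Finset.sum_sub_distrib, Finset.sum_const, Finset.card_range, smul_sub,
      ← Nat.cast_smul_eq_nsmul ℝ, smul_smul, inv_mul_cancel₀ hn'.ne', one_smul]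
  have hSint : Integrable (fun ω => ‖S ω‖ ^ 2) P := by
    have hSm : AEStronglyMeasurable S P :=
      Finset.aestronglyMeasurable_fun_sum _ fun i _ =>
        (hf.aestronglyMeasurable.comp_aemeasurable (hZs i)).sub aestronglyMeasurable_const
    refine .of_bound (hSm.norm.pow 2) ((n * (C + ‖m‖)) ^ 2) (ae_of_all _ fun ω => ?_)
    rw [Real.norm_of_nonneg (by positivity)]
    refine pow_le_pow_left₀ (norm_nonneg _) ?_ 2
    refine (norm_sum_le _ _).trans ((Finset.sum_le_sum (g := fun _ => C + ‖m‖) fun i _ =>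
      (norm_sub_le _ _).trans (by gcongr; exact hC _)).trans ?_)
    simp [mul_add]
  have hsub : {ω | t < ‖empMean n (fun i => f (Zs i ω)) - m‖}
      ⊆ {ω | (n * t) ^ 2 ≤ ‖S ω‖ ^ 2} := by
    intro ω hω
    simp only [Set.mem_ofPred_eq, hemp, norm_smul, norm_inv, Real.norm_natCast] at hω ⊢
    refine pow_le_pow_left₀ (by positivity) ?_ 2
    rw [lt_inv_mul_iff₀ hn'] at hω
    exact hω.le
  have hmk := mul_meas_ge_le_integral_of_nonneg (μ := P) (ae_of_all _ fun ω => by positivity)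
    hSint ((n * t) ^ 2)
  have hvar : ∫ ω, ‖S ω‖ ^ 2 ∂P ≤ n * V :=
    (integral_norm_sum_sub_sq_le hindep hident hf hC n).trans (mul_le_mul_of_nonneg_left
      ((integral_norm_sub_integral_sq_le (hident 0).aemeasurable_snd hf hC).trans hV) hn'.le)
  refine (measure_mono hsub).trans ?_
  rw [← ofReal_measureReal]
  refine ENNReal.ofReal_le_ofReal ?_
  rw [le_div_iff₀ (by positivity)]
  have : n * (P.real {ω | (n * t) ^ 2 ≤ ‖S ω‖ ^ 2} * (n * t ^ 2)) ≤ n * V := by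
    calc _ = (n * t) ^ 2 * P.real {ω | (n * t) ^ 2 ≤ ‖S ω‖ ^ 2} := by ring
      _ ≤ _ := hmk.trans hvar
  exact le_of_mul_le_mul_left this hn'

end WeakLaw

/-! ### Tensors as Hilbert–Schmidt operators -/

/-- A linear contraction extends to the completion of its domain. -/
theorem exists_extension_completion {V F : Type*} [NormedAddCommGroup V] [NormedSpace ℝ V]
    [NormedAddCommGroup F] [NormedSpace ℝ F] [CompleteSpace F] (f : V →ₗ[ℝ] F)
    (hf : ∀ x, ‖f x‖ ≤ ‖x‖) :
    ∃ g : UniformSpace.Completion V →L[ℝ] F, (∀ x : V, g x = f x) ∧ ∀ t, ‖g t‖ ≤ ‖t‖ := by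
  have hd : DenseRange ((UniformSpace.Completion.toComplL :
      V →L[ℝ] UniformSpace.Completion V) : V →ₗ[ℝ] UniformSpace.Completion V) :=
    UniformSpace.Completion.denseRange_coe
  have hb : ∀ x : V, ‖f x‖ ≤ 1 * ‖((UniformSpace.Completion.toComplL :
      V →L[ℝ] UniformSpace.Completion V) : V →ₗ[ℝ] UniformSpace.Completion V) x‖ := fun x => by
    simpa using hf x
  refine ⟨f.extendOfNorm (UniformSpace.Completion.toComplL :
    V →L[ℝ] UniformSpace.Completion V), fun x => LinearMap.extendOfNorm_eq hd ⟨1, hb⟩ x,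
    fun t => ?_⟩
  simpa using LinearMap.norm_extendOfNorm_apply_le hd 1 hb t

section HilbertSchmidt

open scoped TensorProduct

variable (H₁ H₂ : Type*) [NormedAddCommGroup H₁] [InnerProductSpace ℝ H₁]
  [NormedAddCommGroup H₂] [InnerProductSpace ℝ H₂]

/-- The Hilbert space tensor product of `H₁` and `H₂`. It plays the role of the space of
Hilbert–Schmidt operators `H₂ → H₁`, the elementary tensor `a ⊗ b` standing for `c ↦ ⟪b, c⟫ a`. -/
abbrev HilbertTensor : Type _ := UniformSpace.Completion (H₁ ⊗[ℝ] H₂)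

variable {H₁ H₂}

/-- The elementary tensor `a ⊗ b` in the completed tensor product. -/
noncomputable def hilbertTmul (a : H₁) (b : H₂) : HilbertTensor H₁ H₂ :=
  ((a ⊗ₜ[ℝ] b : H₁ ⊗[ℝ] H₂) : HilbertTensor H₁ H₂)

theorem norm_hilbertTmul (a : H₁) (b : H₂) : ‖hilbertTmul a b‖ = ‖a‖ * ‖b‖ := by
  rw [hilbertTmul, UniformSpace.Completion.norm_coe, TensorProduct.norm_tmul]

theorem continuous_hilbertTmul : Continuous fun x : H₁ × H₂ => hilbertTmul x.1 x.2 :=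
  (UniformSpace.Completion.continuous_coe _).comp (TensorProduct.continuous_tmul ..)

/-- The operator `H₂ → H₁` represented by an algebraic tensor. -/
noncomputable def tensorToOperatorAlg : H₁ ⊗[ℝ] H₂ →ₗ[ℝ] (H₂ →L[ℝ] H₁) :=
  TensorProduct.lift (LinearMap.mk₂ ℝ (fun a b => InnerProductSpace.rankOne ℝ a b)
    (by simp) (by simp) (by simp) (by simp))

theorem tensorToOperatorAlg_tmul (a : H₁) (b : H₂) :
    tensorToOperatorAlg (a ⊗ₜ[ℝ] b) = InnerProductSpace.rankOne ℝ a b := by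
  simp [tensorToOperatorAlg]

theorem inner_tensorToOperatorAlg (t : H₁ ⊗[ℝ] H₂) (h : H₁) (g : H₂) :
    ⟪h, tensorToOperatorAlg t g⟫_ℝ = ⟪h ⊗ₜ[ℝ] g, t⟫_ℝ := by
  induction t with
  | zero => simp
  | add x y hx hy => simp [inner_add_right, hx, hy]
  | tmul a b =>
    simp [tensorToOperatorAlg_tmul, inner_smul_right, real_inner_comm, mul_comm]

/-- The Hilbert–Schmidt norm dominates the operator norm. -/
theorem norm_tensorToOperatorAlg_le (t : H₁ ⊗[ℝ] H₂) : ‖tensorToOperatorAlg t‖ ≤ ‖t‖ := by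
  refine ContinuousLinearMap.opNorm_le_bound _ (norm_nonneg _) fun g => ?_
  have h := real_inner_le_norm (tensorToOperatorAlg t g ⊗ₜ[ℝ] g) t
  rw [← inner_tensorToOperatorAlg, real_inner_self_eq_norm_sq, TensorProduct.norm_tmul] at h
  rcases (norm_nonneg (tensorToOperatorAlg t g)).eq_or_lt with h0 | h0
  · rw [← h0]; positivity
  · nlinarith

variable (H₁ H₂) in
/-- The contraction from the completed tensor product to the bounded operators `H₂ → H₁`
sending `a ⊗ b` to `c ↦ ⟪b, c⟫ a`. -/
theorem exists_tensorToOperator [CompleteSpace H₁] :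
    ∃ J : HilbertTensor H₁ H₂ →L[ℝ] (H₂ →L[ℝ] H₁),
      (∀ a b, J (hilbertTmul a b) = InnerProductSpace.rankOne ℝ a b) ∧ ∀ t, ‖J t‖ ≤ ‖t‖ := by
  obtain ⟨J, hJ, hJn⟩ := exists_extension_completion (tensorToOperatorAlg (H₁ := H₁) (H₂ := H₂))
    norm_tensorToOperatorAlg_le
  exact ⟨J, fun a b => (hJ _).trans (tensorToOperatorAlg_tmul a b), hJn⟩

end HilbertSchmidt

/-! ### Empirical cross-covariance operators -/

section EmpiricalCovariance

open InnerProductSpace (rankOne)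

variable {V W H₁ H₂ H₃ : Type*} [AddCommGroup V] [Module ℝ V] [AddCommGroup W] [Module ℝ W]
  [NormedAddCommGroup H₁] [InnerProductSpace ℝ H₁]
  [NormedAddCommGroup H₂] [InnerProductSpace ℝ H₂]
  [NormedAddCommGroup H₃] [InnerProductSpace ℝ H₃]

theorem empMean_sub (n : ℕ) (z w : ℕ → V) :
    empMean n (fun i => z i - w i) = empMean n z - empMean n w := by
  simp [empMean, smul_sub]

theorem empMean_const {n : ℕ} (hn : 0 < n) (c : V) : empMean n (fun _ => c) = c := by
  have hn' : (n : ℝ) ≠ 0 := by exact_mod_cast hn.ne'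
  simp [empMean, ← Nat.cast_smul_eq_nsmul ℝ, smul_smul, inv_mul_cancel₀ hn']

theorem map_empMean {F : Type*} [FunLike F V W] [LinearMapClass F ℝ V W] (f : F) (n : ℕ)
    (z : ℕ → V) : f (empMean n z) = empMean n fun i => f (z i) := by
  simp [empMean]

/-- The empirical centring may be replaced by any fixed centring, up to a rank-one correction. -/
theorem empCrossCov_eq_sub_rankOne {n : ℕ} (hn : 0 < n) (z : ℕ → H₁) (w : ℕ → H₂) (c : H₁)
    (d : H₂) :
    empCrossCov n z w = empMean n (fun i => rankOne ℝ (z i - c) (w i - d))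
      - rankOne ℝ (empMean n z - c) (empMean n w - d) := by
  set x := empMean n z - c with hx
  set y := empMean n w - d with hy
  have h i : rankOne ℝ (z i - empMean n z) (w i - empMean n w)
      = rankOne ℝ (z i - c) (w i - d)
        - ((rankOne ℝ).flip y (z i - c) + rankOne ℝ x (w i - d) - rankOne ℝ x y) := by
    have h1 : z i - empMean n z = (z i - c) - x := by rw [hx]; abel
    have h2 : w i - empMean n w = (w i - d) - y := by rw [hy]; abel
    rw [h1, h2]
    simp only [map_sub, sub_apply, ContinuousLinearMap.flip_apply]
    abel
  have hzx : empMean n (fun i => z i - c) = x := by rw [empMean_sub, empMean_const hn]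
  have hwy : empMean n (fun i => w i - d) = y := by rw [empMean_sub, empMean_const hn]
  have h3 : empMean n (fun i => (rankOne ℝ).flip y (z i - c) + rankOne ℝ x (w i - d)
      - rankOne ℝ x y) = rankOne ℝ x y := by
    have e1 := map_empMean ((rankOne ℝ).flip y) n (fun i => z i - c)
    have e2 := map_empMean (rankOne ℝ x) n (fun i => w i - d)
    rw [hzx] at e1
    rw [hwy] at e2
    rw [empMean_sub, empMean_const hn]
    have : empMean n (fun i => (rankOne ℝ).flip y (z i - c) + rankOne ℝ x (w i - d))
        = rankOne ℝ x y + rankOne ℝ x y := by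
      rw [ContinuousLinearMap.flip_apply] at e1
      nth_rewrite 1 [e1]
      rw [e2]
      simp [empMean, Finset.sum_add_distrib]
    rw [this]; abel
  unfold empCrossCov
  simp_rw [h]
  rw [empMean_sub, h3]

theorem comp_empCrossCov (n : ℕ) (G : H₁ →L[ℝ] H₃) (z : ℕ → H₁) (w : ℕ → H₂) :
    G ∘L empCrossCov n z w = empCrossCov n (fun i => G (z i)) w := by
  ext g
  simp [empCrossCov, empMean]

/-- The empirical cross-covariance with the residual `w - R* z` of a linear regression. -/
theorem empCrossCov_sub_adjoint [CompleteSpace H₁] [CompleteSpace H₂] (n : ℕ) (R : H₂ →L[ℝ] H₁)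
    (z : ℕ → H₁) (w : ℕ → H₂) :
    empCrossCov n z (fun i => w i - R.adjoint (z i))
      = empCrossCov n z w - empCrossCov n z z ∘L R := by
  ext g
  have h i : ⟪w i - R.adjoint (z i) - empMean n (fun i => w i - R.adjoint (z i)), g⟫_ℝ
      = ⟪w i - empMean n w, g⟫_ℝ - ⟪z i - empMean n z, R g⟫_ℝ := by
    rw [empMean_sub, ← map_empMean R.adjoint, ← ContinuousLinearMap.adjoint_inner_left, map_sub]
    simp only [inner_sub_left]
    ring
  simp only [empCrossCov, empMean, smul_apply, sum_apply,
    sub_apply, ContinuousLinearMap.comp_apply,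
    InnerProductSpace.rankOne_apply] at h ⊢
  simp_rw [h, sub_smul, Finset.sum_sub_distrib, smul_sub]

theorem inner_empCrossCov_self_nonneg (n : ℕ) (z : ℕ → H₁) (f : H₁) :
    0 ≤ ⟪empCrossCov n z z f, f⟫_ℝ := by
  simp only [empCrossCov, empMean, smul_apply, sum_apply,
    InnerProductSpace.rankOne_apply, real_inner_smul_left, sum_inner]
  exact mul_nonneg (by positivity) (Finset.sum_nonneg fun i _ => mul_self_nonneg _)

end EmpiricalCovariance

/-! ### Concentration of empirical cross-covariance operators -/

section Covariance

open InnerProductSpace (rankOne)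

variable {Ω E H₁ H₂ H₃ : Type*} [MeasurableSpace Ω] [MeasurableSpace E] {P : Measure Ω}
  [IsProbabilityMeasure P]
  [NormedAddCommGroup H₁] [InnerProductSpace ℝ H₁] [CompleteSpace H₁]
  [NormedAddCommGroup H₂] [InnerProductSpace ℝ H₂] [CompleteSpace H₂]
  [NormedAddCommGroup H₃] [InnerProductSpace ℝ H₃] [CompleteSpace H₃]

omit [CompleteSpace H₂] in
theorem integrable_rankOne {z : Ω → H₁} {w : Ω → H₂} {A B : ℝ}
    (hz : AEStronglyMeasurable z P) (hw : AEStronglyMeasurable w P)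
    (hA : ∀ ω, ‖z ω‖ ≤ A) (hB : ∀ ω, ‖w ω‖ ≤ B) :
    Integrable (fun ω => rankOne ℝ (z ω) (w ω)) P := by
  obtain ⟨J, hJ, -⟩ := exists_tensorToOperator H₁ H₂
  have hm : AEStronglyMeasurable (fun ω => hilbertTmul (z ω) (w ω)) P :=
    continuous_hilbertTmul.comp_aestronglyMeasurable₂ (g := fun a b => hilbertTmul a b) hz hw
  have h : Integrable (fun ω => hilbertTmul (z ω) (w ω)) P := by
    refine .of_bound hm (A * B) (ae_of_all _ fun ω => ?_)
    rw [norm_hilbertTmul]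
    exact mul_le_mul (hA ω) (hB ω) (norm_nonneg _) ((norm_nonneg _).trans (hA ω))
  have h' := J.integrable_comp h
  simp only [hJ] at h'
  exact h'

omit [CompleteSpace H₁] in
theorem norm_sub_integral_le {z : Ω → H₁} {A : ℝ} (hA : ∀ ω, ‖z ω‖ ≤ A) (ω : Ω) :
    ‖z ω - ∫ ω', z ω' ∂P‖ ≤ 2 * A := by
  have h : ‖∫ ω', z ω' ∂P‖ ≤ A := by
    simpa using norm_integral_le_of_norm_le_const (ae_of_all P hA)
  linarith [norm_sub_le (z ω) (∫ ω', z ω' ∂P), hA ω]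

omit [CompleteSpace H₂] in
theorem integrable_rankOne_centered {z : Ω → H₁} {w : Ω → H₂} {A B : ℝ}
    (hz : AEStronglyMeasurable z P) (hw : AEStronglyMeasurable w P)
    (hA : ∀ ω, ‖z ω‖ ≤ A) (hB : ∀ ω, ‖w ω‖ ≤ B) :
    Integrable (fun ω => rankOne ℝ (z ω - ∫ ω', z ω' ∂P) (w ω - ∫ ω', w ω' ∂P)) P :=
  integrable_rankOne (hz.sub aestronglyMeasurable_const) (hw.sub aestronglyMeasurable_const)
    (norm_sub_integral_le hA) (norm_sub_integral_le hB)

omit [CompleteSpace H₂] in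
theorem comp_crossCov (G : H₁ →L[ℝ] H₃) {z : Ω → H₁} {w : Ω → H₂} {A B : ℝ}
    (hz : AEStronglyMeasurable z P) (hw : AEStronglyMeasurable w P)
    (hA : ∀ ω, ‖z ω‖ ≤ A) (hB : ∀ ω, ‖w ω‖ ≤ B) :
    G ∘L crossCov P z w = crossCov P (fun ω => G (z ω)) w := by
  have h := (ContinuousLinearMap.compL ℝ H₂ H₁ H₃ G).integral_comp_comm
    (integrable_rankOne_centered hz hw hA hB)
  simp only [ContinuousLinearMap.compL_apply] at h
  rw [crossCov, ← h, crossCov, G.integral_comp_comm (.of_bound hz A (ae_of_all _ hA))]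
  congr 1
  ext ω g
  simp

theorem crossCov_sub_adjoint (R : H₂ →L[ℝ] H₁) {z : Ω → H₁} {w : Ω → H₂} {A B : ℝ}
    (hz : AEStronglyMeasurable z P) (hw : AEStronglyMeasurable w P)
    (hA : ∀ ω, ‖z ω‖ ≤ A) (hB : ∀ ω, ‖w ω‖ ≤ B) :
    crossCov P z (fun ω => w ω - R.adjoint (z ω)) = crossCov P z w - crossCov P z z ∘L R := by
  have hzi : Integrable z P := .of_bound hz A (ae_of_all _ hA)
  have hwi : Integrable w P := .of_bound hw B (ae_of_all _ hB)
  have h := ((ContinuousLinearMap.compL ℝ H₂ H₁ H₁).flip R).integral_comp_comm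
    (integrable_rankOne_centered hz hz hA hA)
  have h' : (∫ ω, rankOne ℝ (z ω - ∫ ω', z ω' ∂P) (z ω - ∫ ω', z ω' ∂P) ∘L R ∂P)
      = crossCov P z z ∘L R := h
  have hR : Integrable (fun ω =>
      rankOne ℝ (z ω - ∫ ω', z ω' ∂P) (z ω - ∫ ω', z ω' ∂P) ∘L R) P :=
    ((ContinuousLinearMap.compL ℝ H₂ H₁ H₁).flip R).integrable_comp
      (integrable_rankOne_centered hz hz hA hA)
  rw [← h', crossCov, crossCov, ← integral_sub (integrable_rankOne_centered hz hw hA hB) hR,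
    integral_sub hwi (R.adjoint.integrable_comp hzi), R.adjoint.integral_comp_comm hzi]
  congr 1
  ext ω g
  have : ⟪w ω - R.adjoint (z ω) - ((∫ ω', w ω' ∂P) - R.adjoint (∫ ω', z ω' ∂P)), g⟫_ℝ
      = ⟪w ω - ∫ ω', w ω' ∂P, g⟫_ℝ - ⟪z ω - ∫ ω', z ω' ∂P, R g⟫_ℝ := by
    rw [← ContinuousLinearMap.adjoint_inner_left, map_sub]
    simp only [inner_sub_left]
    ring
  simp only [InnerProductSpace.rankOne_apply, sub_apply,
    ContinuousLinearMap.comp_apply, this, sub_smul]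

omit [CompleteSpace H₂] in
theorem inner_crossCov {z : Ω → H₁} {w : Ω → H₂} {A B : ℝ}
    (hz : AEStronglyMeasurable z P) (hw : AEStronglyMeasurable w P)
    (hA : ∀ ω, ‖z ω‖ ≤ A) (hB : ∀ ω, ‖w ω‖ ≤ B) (f : H₁) (g : H₂) :
    ⟪f, crossCov P z w g⟫_ℝ
      = ∫ ω, ⟪f, z ω - ∫ ω', z ω' ∂P⟫_ℝ * ⟪w ω - ∫ ω', w ω' ∂P, g⟫_ℝ ∂P := by
  have hi := integrable_rankOne_centered hz hw hA hB
  rw [crossCov, ContinuousLinearMap.integral_apply hi,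
    ← integral_inner (hi.apply_continuousLinearMap g)]
  congr 1
  ext ω
  rw [InnerProductSpace.rankOne_apply, real_inner_smul_right, mul_comm]

omit [CompleteSpace H₂] in
/-- Concentration of the empirical cross-covariance operator of a sample of bounded random
elements. Only the variance `V` of the first element enters quadratically; the second element
enters through its uniform bound `B`. The operator norm is dominated by the norm of the centred
empirical mean in the Hilbert tensor product, where Chebyshev's inequality applies, and the
correction for the empirical centring is a rank-one operator. -/
theorem measure_lt_norm_empCrossCov_sub_le {Z : Ω → E} {Zs : ℕ → Ω → E}
    (hindep : iIndepFun Zs P) (hident : ∀ i, IdentDistrib (Zs i) Z P P)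
    {a : E → H₁} {b : E → H₂} (ha : StronglyMeasurable a) (hb : StronglyMeasurable b)
    {A B : ℝ} (hA : ∀ z, ‖a z‖ ≤ A) (hB0 : 0 < B) (hB : ∀ z, ‖b z‖ ≤ B) {n : ℕ} (hn : 0 < n)
    {t V : ℝ} (ht : 0 < t) (hV : ∫ ω, ‖a (Z ω) - ∫ ω', a (Z ω') ∂P‖ ^ 2 ∂P ≤ V) :
    P {ω | 4 * B * t < ‖empCrossCov n (fun i => a (Zs i ω)) (fun i => b (Zs i ω))
        - crossCov P (fun ω => a (Z ω)) (fun ω => b (Z ω))‖}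
      ≤ ENNReal.ofReal (V / (n * t ^ 2)) + ENNReal.ofReal (V / (n * t ^ 2)) := by
  obtain ⟨J, hJ, hJn⟩ := exists_tensorToOperator H₁ H₂
  have hZ := (hident 0).aemeasurable_snd
  set ma := ∫ ω', a (Z ω') ∂P with hma
  set mb := ∫ ω', b (Z ω') ∂P with hmb
  have hmaA : ‖ma‖ ≤ A := by
    simpa using norm_integral_le_of_norm_le_const (ae_of_all P fun ω => hA (Z ω))
  have hmbB : ‖mb‖ ≤ B := by
    simpa using norm_integral_le_of_norm_le_const (ae_of_all P fun ω => hB (Z ω))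
  set u : E → H₁ := fun z => a z - ma with hu
  set v : E → H₂ := fun z => b z - mb with hv
  have hum : StronglyMeasurable u := ha.sub stronglyMeasurable_const
  have hvm : StronglyMeasurable v := hb.sub stronglyMeasurable_const
  have huA z : ‖u z‖ ≤ 2 * A := by linarith [norm_sub_le (a z) ma, hA z]
  have hvB z : ‖v z‖ ≤ 2 * B := by linarith [norm_sub_le (b z) mb, hB z]
  have hu0 : ∫ ω, u (Z ω) ∂P = 0 := by
    rw [integral_sub (integrable_comp_of_norm_le hZ ha hA) (integrable_const _)]
    simp [hma]
  set ξ : E → HilbertTensor H₁ H₂ := fun z => hilbertTmul (u z) (v z) with hξ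
  have hξm : StronglyMeasurable ξ :=
    continuous_hilbertTmul.comp_stronglyMeasurable (g := fun x : H₁ × H₂ => hilbertTmul x.1 x.2)
      (f := fun z => (u z, v z)) (hum.prodMk hvm)
  have hξn z : ‖ξ z‖ = ‖u z‖ * ‖v z‖ := norm_hilbertTmul _ _
  have hξC z : ‖ξ z‖ ≤ 2 * A * (2 * B) := by
    rw [hξn]
    exact mul_le_mul (huA z) (hvB z) (norm_nonneg _) ((norm_nonneg _).trans (huA z))
  have hu2 : Integrable (fun ω => ‖u (Z ω)‖ ^ 2) P :=
    integrable_comp_of_norm_le hZ (f := fun z => ‖u z‖ ^ 2) (hum.norm.pow 2) (C := (2 * A) ^ 2)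
      fun z => by
        rw [Real.norm_of_nonneg (by positivity)]
        exact pow_le_pow_left₀ (norm_nonneg _) (huA z) 2
  have hξV : ∫ ω, ‖ξ (Z ω)‖ ^ 2 ∂P ≤ (2 * B) ^ 2 * V := by
    calc ∫ ω, ‖ξ (Z ω)‖ ^ 2 ∂P ≤ ∫ ω, (2 * B) ^ 2 * ‖u (Z ω)‖ ^ 2 ∂P := by
          refine integral_mono_of_nonneg (ae_of_all _ fun ω => by positivity)
            (hu2.const_mul _) (ae_of_all _ fun ω => ?_)
          dsimp only
          rw [hξn, mul_pow, mul_comm]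
          gcongr
          exact hvB _
      _ ≤ _ := by
          rw [integral_const_mul]
          gcongr
  have h1 := measure_lt_norm_empMean_sub_le hindep hident hum huA hn ht hV
  have h2 := measure_lt_norm_empMean_sub_le hindep hident hξm hξC hn
    (mul_pos (mul_pos two_pos hB0) ht) hξV
  have hsimp : (2 * B) ^ 2 * V / (n * (2 * B * t) ^ 2) = V / (n * t ^ 2) := by
    have : (2 * B) ^ 2 ≠ 0 := by positivity
    rw [mul_pow _ t, mul_left_comm, mul_div_mul_left _ _ this]
  rw [hsimp] at h2
  refine (measure_mono (fun ω hω => ?_)).trans ((measure_union_le _ _).trans (add_le_add h1 h2))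
  by_contra hcon
  simp only [Set.mem_union, Set.mem_ofPred_eq, not_or, not_lt, hu0, sub_zero] at hcon hω
  obtain ⟨hc1, hc2⟩ := hcon
  refine absurd hω (not_lt.2 ?_)
  have hum' : empMean n (fun i => u (Zs i ω)) = empMean n (fun i => a (Zs i ω)) - ma := by
    rw [empMean_sub, empMean_const hn]
  have hvm' : ‖empMean n (fun i => b (Zs i ω)) - mb‖ ≤ 2 * B := by
    have hn' : (0 : ℝ) < n := by exact_mod_cast hn
    rw [← empMean_const hn mb, ← empMean_sub, empMean, norm_smul, norm_inv, Real.norm_natCast,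
      inv_mul_le_iff₀ hn']
    refine (norm_sum_le _ _).trans ((Finset.sum_le_sum (g := fun _ => 2 * B)
      fun i _ => hvB (Zs i ω)).trans ?_)
    simp
  have hJξ : J (empMean n (fun i => ξ (Zs i ω)) - ∫ ω', ξ (Z ω') ∂P)
      = empMean n (fun i => rankOne ℝ (u (Zs i ω)) (v (Zs i ω)))
        - crossCov P (fun ω => a (Z ω)) (fun ω => b (Z ω)) := by
    rw [map_sub, map_empMean, ← J.integral_comp_comm (integrable_comp_of_norm_le hZ hξm hξC)]
    simp only [hξ, hJ]
    rfl
  rw [empCrossCov_eq_sub_rankOne hn _ _ ma mb, sub_right_comm, ← hJξ]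
  calc _ ≤ ‖J (empMean n (fun i => ξ (Zs i ω)) - ∫ ω', ξ (Z ω') ∂P)‖
        + ‖rankOne ℝ (empMean n (fun i => a (Zs i ω)) - ma)
          (empMean n (fun i => b (Zs i ω)) - mb)‖ := norm_sub_le _ _
    _ ≤ 2 * B * t + t * (2 * B) := by
        rw [InnerProductSpace.norm_rankOne, ← hum']
        exact add_le_add ((hJn _).trans hc2) (mul_le_mul hc1 hvm' (norm_nonneg _) ht.le)
    _ = 4 * B * t := by ring

end Covariance

/-! ### Resolvents of positive operators -/

section Resolvent

variable {H : Type*} [NormedAddCommGroup H] [InnerProductSpace ℝ H] [CompleteSpace H]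
  {A : H →L[ℝ] H} {ε : ℝ}

omit [CompleteSpace H] in
theorem norm_sq_mul_le_inner_add_smul (hA : ∀ f, 0 ≤ ⟪A f, f⟫_ℝ) (f : H) :
    ‖f‖ ^ 2 * ε ≤ ⟪(A + ε • (1 : H →L[ℝ] H)) f, f⟫_ℝ := by
  have : ⟪(A + ε • (1 : H →L[ℝ] H)) f, f⟫_ℝ = ⟪A f, f⟫_ℝ + ε * ‖f‖ ^ 2 := by
    simp [inner_add_left, real_inner_smul_left]
  rw [this]
  linarith [hA f]

theorem isUnit_add_smul_one (hA : ∀ f, 0 ≤ ⟪A f, f⟫_ℝ) (hε : 0 < ε) :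
    IsUnit (A + ε • (1 : H →L[ℝ] H)) := by
  refine ContinuousLinearMap.isUnit_of_forall_le_norm_inner_map _ (c := ⟨ε, hε.le⟩) hε fun f => ?_
  exact (norm_sq_mul_le_inner_add_smul hA f).trans (le_abs_self _)

theorem norm_ringInverse_add_smul_one_le (hA : ∀ f, 0 ≤ ⟪A f, f⟫_ℝ) (hε : 0 < ε) :
    ‖Ring.inverse (A + ε • (1 : H →L[ℝ] H))‖ ≤ ε⁻¹ := by
  refine ContinuousLinearMap.opNorm_le_bound _ (by positivity) fun f => ?_
  set G := Ring.inverse (A + ε • (1 : H →L[ℝ] H)) with hG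
  have h1 : (A + ε • (1 : H →L[ℝ] H)) (G f) = f :=
    DFunLike.congr_fun (Ring.mul_inverse_cancel _ (isUnit_add_smul_one hA hε)) f
  have h2 := norm_sq_mul_le_inner_add_smul (ε := ε) hA (G f)
  rw [h1] at h2
  have h3 := h2.trans (real_inner_le_norm f (G f))
  rw [le_inv_mul_iff₀ hε]
  rcases (norm_nonneg (G f)).eq_or_lt with h0 | h0
  · rw [← h0]; simp
  · nlinarith

end Resolvent

/-! ### Spectral calculus in an eigensystem -/

section Spectral

variable {H : Type*} [NormedAddCommGroup H] [InnerProductSpace ℝ H]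
  {A : H →L[ℝ] H} {lam : ℕ → ℝ} {φ : ℕ → H}

theorem inner_eq_of_hasSum_orthonormal (hφ : Orthonormal ℝ φ) {c : ℕ → ℝ} {f y : H}
    (h : HasSum (fun j => c j • ⟪φ j, f⟫_ℝ • φ j) y) (j : ℕ) :
    ⟪φ j, y⟫_ℝ = c j * ⟪φ j, f⟫_ℝ := by
  have h1 : HasSum (fun i => ⟪φ j, c i • ⟪φ i, f⟫_ℝ • φ i⟫_ℝ) ⟪φ j, y⟫_ℝ :=
    h.mapL (innerSL ℝ (φ j))
  refine h1.unique ?_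
  convert! hasSum_single (f := fun i => ⟪φ j, c i • ⟪φ i, f⟫_ℝ • φ i⟫_ℝ) j fun i hi => ?_ using 1
  · simp [real_inner_smul_right, hφ.1 j]
  · simp [real_inner_smul_right, hφ.2 hi.symm]

namespace IsEigenSystem

theorem inner_map (h : IsEigenSystem A lam φ) (j : ℕ) (f : H) :
    ⟪φ j, A f⟫_ℝ = lam j * ⟪φ j, f⟫_ℝ :=
  inner_eq_of_hasSum_orthonormal h.orthonormal (h.hasSum f) j

theorem hasSum_inner (h : IsEigenSystem A lam φ) (f g : H) :
    HasSum (fun j => lam j * ⟪φ j, f⟫_ℝ * ⟪g, φ j⟫_ℝ) ⟪g, A f⟫_ℝ := by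
  have h1 : HasSum (fun j => ⟪g, lam j • ⟪φ j, f⟫_ℝ • φ j⟫_ℝ) ⟪g, A f⟫_ℝ :=
    (h.hasSum f).mapL (innerSL ℝ g)
  simpa [real_inner_smul_right, mul_assoc] using h1

theorem inner_self_nonneg (h : IsEigenSystem A lam φ) (hlam : ∀ j, 0 < lam j) (f : H) :
    0 ≤ ⟪A f, f⟫_ℝ := by
  rw [real_inner_comm]
  refine (h.hasSum_inner f f).nonneg fun j => ?_
  rw [mul_assoc, real_inner_comm (φ j) f]
  exact mul_nonneg (hlam j).le (mul_self_nonneg _)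

theorem inner_eq_zero_of_map_eq_zero (h : IsEigenSystem A lam φ) (hlam : ∀ j, 0 < lam j) {k : H}
    (hk : A k = 0) (j : ℕ) : ⟪φ j, k⟫_ℝ = 0 := by
  have := h.inner_map j k
  rw [hk, inner_zero_right] at this
  exact (mul_eq_zero.1 this.symm).resolve_left (hlam j).ne'

theorem map_mem_ker_orthogonal (h : IsEigenSystem A lam φ) (hlam : ∀ j, 0 < lam j) (f : H) :
    A f ∈ (LinearMap.ker (A : H →ₗ[ℝ] H))ᗮ := by
  rw [Submodule.mem_orthogonal]
  intro k hk
  refine (h.hasSum_inner f k).unique ?_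
  have : ∀ j, lam j * ⟪φ j, f⟫_ℝ * ⟪k, φ j⟫_ℝ = 0 := fun j => by
    rw [real_inner_comm (φ j) k, h.inner_eq_zero_of_map_eq_zero hlam hk, mul_zero]
  simp_rw [this]
  exact hasSum_zero

/-- Parseval's identity: the eigenfunctions form a Hilbert basis of `(ker A)ᗮ`. -/
theorem hasSum_inner_sq [CompleteSpace H] (h : IsEigenSystem A lam φ) (hlam : ∀ j, 0 < lam j)
    {x : H} (hx : x ∈ (LinearMap.ker (A : H →ₗ[ℝ] H))ᗮ) :
    HasSum (fun j => ⟪φ j, x⟫_ℝ ^ 2) (‖x‖ ^ 2) := by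
  set M := (LinearMap.ker (A : H →ₗ[ℝ] H))ᗮ with hM
  have hφM j : φ j ∈ M := by
    rw [hM, Submodule.mem_orthogonal]
    intro k hk
    rw [real_inner_comm, h.inner_eq_zero_of_map_eq_zero hlam hk]
  set e : ℕ → M := fun j => ⟨φ j, hφM j⟩ with he
  have heo : Orthonormal ℝ e :=
    ⟨fun j => h.orthonormal.1 j, fun i j hij => h.orthonormal.2 hij⟩
  have hbot : (Submodule.span ℝ (Set.range e))ᗮ = ⊥ := by
    rw [Submodule.eq_bot_iff]
    intro y hy
    have hyj j : ⟪φ j, (y : H)⟫_ℝ = 0 :=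
      (Submodule.mem_orthogonal _ _).1 hy (e j) (Submodule.subset_span ⟨j, rfl⟩)
    have hAy : A (y : H) = 0 := by
      refine (h.hasSum (y : H)).unique ?_
      simp_rw [hyj, zero_smul, smul_zero]
      exact hasSum_zero
    have h0 : ⟪(y : H), (y : H)⟫_ℝ = 0 := (Submodule.mem_orthogonal _ _).1 y.2 y hAy
    exact Subtype.ext (inner_self_eq_zero.1 h0)
  have h1 := (HilbertBasis.mkOfOrthogonalEqBot heo hbot).hasSum_inner_mul_inner ⟨x, hx⟩ ⟨x, hx⟩
  rw [HilbertBasis.coe_mkOfOrthogonalEqBot, real_inner_self_eq_norm_sq] at h1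
  convert! h1 using 1
  ext j
  rw [sq]
  nth_rewrite 1 [real_inner_comm]
  rfl

variable [CompleteSpace H] {ε : ℝ}

theorem add_smul_ringInverse_apply (h : IsEigenSystem A lam φ) (hlam : ∀ j, 0 < lam j)
    (hε : 0 < ε) (x : H) :
    A (Ring.inverse (A + ε • (1 : H →L[ℝ] H)) x)
      + ε • Ring.inverse (A + ε • (1 : H →L[ℝ] H)) x = x :=
  DFunLike.congr_fun (Ring.mul_inverse_cancel _
    (isUnit_add_smul_one (h.inner_self_nonneg hlam) hε)) x

theorem inner_ringInverse (h : IsEigenSystem A lam φ) (hlam : ∀ j, 0 < lam j) (hε : 0 < ε)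
    (j : ℕ) (x : H) :
    ⟪φ j, Ring.inverse (A + ε • (1 : H →L[ℝ] H)) x⟫_ℝ = ⟪φ j, x⟫_ℝ / (lam j + ε) := by
  have h1 := congrArg (fun y => ⟪φ j, y⟫_ℝ) (h.add_smul_ringInverse_apply hlam hε x)
  simp only [inner_add_right, h.inner_map, real_inner_smul_right] at h1
  rw [eq_div_iff (by linarith [hlam j]), ← h1]
  ring

theorem ringInverse_mem_ker_orthogonal (h : IsEigenSystem A lam φ) (hlam : ∀ j, 0 < lam j)
    (hε : 0 < ε) {x : H} (hx : x ∈ (LinearMap.ker (A : H →ₗ[ℝ] H))ᗮ) :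
    Ring.inverse (A + ε • (1 : H →L[ℝ] H)) x ∈ (LinearMap.ker (A : H →ₗ[ℝ] H))ᗮ := by
  set u := Ring.inverse (A + ε • (1 : H →L[ℝ] H)) x with hu
  have h1 : ε • u = x - A u := by
    rw [eq_sub_iff_add_eq, add_comm]
    exact h.add_smul_ringInverse_apply hlam hε x
  have h2 : u = ε⁻¹ • (x - A u) := by rw [← h1, smul_smul, inv_mul_cancel₀ hε.ne', one_smul]
  rw [h2]
  exact Submodule.smul_mem _ _ (Submodule.sub_mem _ hx (h.map_mem_ker_orthogonal hlam u))

theorem hasSum_norm_ringInverse_sq (h : IsEigenSystem A lam φ) (hlam : ∀ j, 0 < lam j)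
    (hε : 0 < ε) {x : H} (hx : x ∈ (LinearMap.ker (A : H →ₗ[ℝ] H))ᗮ) :
    HasSum (fun j => ⟪φ j, x⟫_ℝ ^ 2 / (lam j + ε) ^ 2)
      (‖Ring.inverse (A + ε • (1 : H →L[ℝ] H)) x‖ ^ 2) := by
  have h1 := h.hasSum_inner_sq hlam (h.ringInverse_mem_ker_orthogonal hlam hε hx)
  simpa only [h.inner_ringInverse hlam hε, div_pow] using h1

end IsEigenSystem

/-- The scalar inequality behind the qualification `β ∧ 1` of Tikhonov regularization. -/
theorem rpow_le_mul_rpow_mul_add {l L ε β : ℝ} (hl : 0 < l) (hL : l ≤ L) (hε : 0 < ε)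
    (hβ : 0 < β) :
    l ^ β ≤ L ^ (β - min β 1) * ε ^ (min β 1 - 1) * (l + ε) := by
  have hb0 : 0 ≤ min β 1 := le_min hβ.le zero_le_one
  have h1 : l ^ min β 1 ≤ ε ^ (min β 1 - 1) * (l + ε) := by
    calc l ^ min β 1 ≤ (l + ε) ^ min β 1 := Real.rpow_le_rpow hl.le (by linarith) hb0
      _ = (l + ε) ^ (min β 1 - 1) * (l + ε) := by
        rw [Real.rpow_sub_one (by linarith), div_mul_cancel₀ _ (by linarith)]
      _ ≤ _ := mul_le_mul_of_nonneg_right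
        (Real.rpow_le_rpow_of_nonpos hε (by linarith) (by linarith [min_le_right β 1]))
        (by linarith)
  calc l ^ β = l ^ (β - min β 1) * l ^ min β 1 := by
        rw [← Real.rpow_add hl, sub_add_cancel]
    _ ≤ L ^ (β - min β 1) * (ε ^ (min β 1 - 1) * (l + ε)) :=
        mul_le_mul (Real.rpow_le_rpow hl.le hL (by linarith [min_le_left β 1])) h1
          (by positivity) (Real.rpow_nonneg (hl.le.trans hL) _)
    _ = _ := by ring

/-- The approximation error: if `r ∈ (ker A)ᗮ` satisfies the source condition
`A r = A ^ (1 + β) s`, then `‖(A + ε)⁻¹ r‖` is of order `ε ^ (β ∧ 1 - 1)`. -/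
theorem IsEigenSystem.norm_ringInverse_le_of_source [CompleteSpace H] {L ε β : ℝ}
    (h : IsEigenSystem A lam φ)
    (hlam : ∀ j, 0 < lam j) (hL : ∀ j, lam j ≤ L) (hε : 0 < ε) (hβ : 0 < β) {T : H →L[ℝ] H}
    (hT : IsSpectralPower lam φ (1 + β) T) {r s : H}
    (hr : r ∈ (LinearMap.ker (A : H →ₗ[ℝ] H))ᗮ) (hrs : A r = T s) :
    ‖Ring.inverse (A + ε • (1 : H →L[ℝ] H)) r‖
      ≤ L ^ (β - min β 1) * ε ^ (min β 1 - 1) * ‖s‖ := by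
  set c := L ^ (β - min β 1) * ε ^ (min β 1 - 1) with hc
  have hc0 : 0 ≤ c := mul_nonneg (Real.rpow_nonneg ((hlam 0).le.trans (hL 0)) _) (by positivity)
  have hcoef j : ⟪φ j, r⟫_ℝ = lam j ^ β * ⟪φ j, s⟫_ℝ := by
    have h1 := h.inner_map j r
    rw [hrs, inner_eq_of_hasSum_orthonormal h.orthonormal (hT s) j, Real.rpow_add (hlam j),
      Real.rpow_one, mul_assoc] at h1
    exact (mul_left_cancel₀ (hlam j).ne' h1).symm
  have hsq : ‖Ring.inverse (A + ε • (1 : H →L[ℝ] H)) r‖ ^ 2 ≤ (c * ‖s‖) ^ 2 := by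
    rw [← (h.hasSum_norm_ringInverse_sq hlam hε hr).tsum_eq, mul_pow]
    have hbes : ∑' j, ‖⟪φ j, s⟫_ℝ‖ ^ 2 ≤ ‖s‖ ^ 2 := h.orthonormal.tsum_inner_products_le s
    refine le_trans ?_ (mul_le_mul_of_nonneg_left hbes (sq_nonneg c))
    rw [← tsum_mul_left]
    refine (h.hasSum_norm_ringInverse_sq hlam hε hr).summable.tsum_le_tsum (fun j => ?_)
      ((h.orthonormal.inner_products_summable s).mul_left _)
    have hpos : 0 < lam j + ε := by linarith [hlam j]
    rw [hcoef, Real.norm_eq_abs, sq_abs, div_le_iff₀ (by positivity)]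
    have h2 := rpow_le_mul_rpow_mul_add (hlam j) (hL j) hε hβ
    have h3 : (lam j ^ β) ^ 2 ≤ (c * (lam j + ε)) ^ 2 :=
      pow_le_pow_left₀ (Real.rpow_nonneg (hlam j).le _) h2 2
    calc (lam j ^ β * ⟪φ j, s⟫_ℝ) ^ 2 = (lam j ^ β) ^ 2 * ⟪φ j, s⟫_ℝ ^ 2 := mul_pow _ _ _
      _ ≤ (c * (lam j + ε)) ^ 2 * ⟪φ j, s⟫_ℝ ^ 2 := by gcongr
      _ = _ := by ring
  exact abs_le_of_sq_le_sq' hsq (by positivity) |>.2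

end Spectral

/-! ### The Moore–Penrose inverse -/

section MoorePenrose

variable {H₁ H₂ : Type*} [NormedAddCommGroup H₁] [InnerProductSpace ℝ H₁] [CompleteSpace H₁]
  [NormedAddCommGroup H₂] [InnerProductSpace ℝ H₂] (A : H₁ →L[ℝ] H₁) (B : H₂ →L[ℝ] H₁)
  (h : LinearMap.range (B : H₂ →ₗ[ℝ] H₁) ≤ LinearMap.range (A : H₁ →ₗ[ℝ] H₁))

theorem regressionMap_mem_ker_orthogonal (g : H₂) :
    regressionMap A B h g ∈ (LinearMap.ker (A : H₁ →ₗ[ℝ] H₁))ᗮ := by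
  simp only [regressionMap, LinearMap.comp_apply]
  exact Subtype.property _

theorem map_regressionMap (g : H₂) : A (regressionMap A B h g) = B g := by
  set y : LinearMap.range (A : H₁ →ₗ[ℝ] H₁) :=
    (B : H₂ →ₗ[ℝ] H₁).codRestrict _ (fun g => h (LinearMap.mem_range_self _ g)) g with hy
  have h1 : restrictKerOrthogonal A (moorePenrose A y) = y :=
    (LinearEquiv.ofBijective (restrictKerOrthogonal A)
      (restrictKerOrthogonal_bijective A)).apply_symm_apply y
  exact congrArg Subtype.val h1

end MoorePenrose

/-! ### The variance of the regularized feature -/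

section EffectiveDimension

variable {Ω H : Type*} [MeasurableSpace Ω] {P : Measure Ω} [IsProbabilityMeasure P]
  [NormedAddCommGroup H] [InnerProductSpace ℝ H] [CompleteSpace H] {z : Ω → H} {C : ℝ}

omit [CompleteSpace H] in
theorem integrable_inner_centered_sq (hz : AEStronglyMeasurable z P) (hC : ∀ ω, ‖z ω‖ ≤ C)
    (k : H) : Integrable (fun ω => ⟪k, z ω - ∫ ω', z ω' ∂P⟫_ℝ ^ 2) P := by
  refine .of_bound (((hz.sub aestronglyMeasurable_const).const_inner (c := k)).pow 2)
    ((‖k‖ * (2 * C)) ^ 2) (ae_of_all _ fun ω => ?_)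
  rw [norm_pow]
  exact pow_le_pow_left₀ (norm_nonneg _) ((norm_inner_le_norm _ _).trans
    (mul_le_mul_of_nonneg_left (norm_sub_integral_le hC ω) (norm_nonneg _))) 2

theorem integral_inner_centered_sq (hz : AEStronglyMeasurable z P) (hC : ∀ ω, ‖z ω‖ ≤ C)
    (k : H) :
    ∫ ω, ⟪k, z ω - ∫ ω', z ω' ∂P⟫_ℝ ^ 2 ∂P = ⟪k, crossCov P z z k⟫_ℝ := by
  rw [inner_crossCov hz hz hC hC]
  congr 1
  ext ω
  rw [sq, real_inner_comm k (z ω - _)]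

/-- A centred random element is almost surely orthogonal to the kernel of its covariance
operator. -/
theorem ae_sub_integral_mem_ker_orthogonal (hz : AEStronglyMeasurable z P)
    (hC : ∀ ω, ‖z ω‖ ≤ C) :
    ∀ᵐ ω ∂P, z ω - ∫ ω', z ω' ∂P
      ∈ (LinearMap.ker (crossCov P z z : H →ₗ[ℝ] H))ᗮ := by
  set N := LinearMap.ker (crossCov P z z : H →ₗ[ℝ] H) with hN
  have : CompleteSpace N := (crossCov P z z).isClosed_ker.completeSpace_coe
  set Q := N.orthogonalProjectionOnto with hQ
  have hm : AEStronglyMeasurable (fun ω => Q (z ω - ∫ ω', z ω' ∂P)) P :=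
    Q.continuous.comp_aestronglyMeasurable (hz.sub aestronglyMeasurable_const)
  -- the almost sure range is separable, so that it suffices to test against countably many
  -- functionals
  obtain ⟨t, ht, hmem⟩ := hm.isSeparable_ae_range
  have h0 : (fun ω => Q (z ω - ∫ ω', z ω' ∂P)) =ᵐ[P] 0 := by
    refine ae_eq_zero_of_forall_dual_of_isSeparable ℝ ht (fun c => ?_) hmem
    set k := (InnerProductSpace.toDual ℝ N).symm c with hk
    have hint := integral_inner_centered_sq hz hC (k : H)
    have hk0 : crossCov P z z (k : H) = 0 := k.2
    rw [hk0, inner_zero_right, integral_eq_zero_iff_of_nonneg (fun ω => sq_nonneg _)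
      (integrable_inner_centered_sq hz hC _)] at hint
    filter_upwards [hint] with ω hω
    have h1 : ⟪(k : H), z ω - ∫ ω', z ω' ∂P⟫_ℝ = 0 := by simpa using hω
    rw [← InnerProductSpace.toDual_symm_apply (𝕜 := ℝ) (y := c), ← hk]
    change ⟪k, Q (z ω - ∫ ω', z ω' ∂P)⟫_ℝ = 0
    rw [hQ, Submodule.inner_orthogonalProjectionOnto_eq_of_mem_left]
    exact h1
  filter_upwards [h0] with ω hω
  exact (Submodule.orthogonalProjectionOnto_eq_zero_iff).1 hω

/-- The mean square of `(Σ + ε)⁻¹ (z - E z)` is `tr ((Σ + ε)⁻² Σ) = ∑ⱼ λⱼ / (λⱼ + ε)²`, where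
`Σ` is the covariance operator of `z`. -/
theorem integral_norm_ringInverse_sq_le {lam : ℕ → ℝ} {φ : ℕ → H}
    (hz : AEStronglyMeasurable z P) (hC : ∀ ω, ‖z ω‖ ≤ C)
    (h : IsEigenSystem (crossCov P z z) lam φ) (hlam : ∀ j, 0 < lam j) {ε : ℝ} (hε : 0 < ε)
    {B : ℝ} (hB : ∀ n, ∑ j ∈ Finset.range n, lam j / (lam j + ε) ^ 2 ≤ B) :
    ∫ ω, ‖Ring.inverse (crossCov P z z + ε • (1 : H →L[ℝ] H)) (z ω - ∫ ω', z ω' ∂P)‖ ^ 2 ∂P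
      ≤ B := by
  have hB0 : 0 ≤ B := by simpa using hB 0
  set G := Ring.inverse (crossCov P z z + ε • (1 : H →L[ℝ] H)) with hG
  set u : Ω → H := fun ω => z ω - ∫ ω', z ω' ∂P with hu
  have hum : AEStronglyMeasurable u P := hz.sub aestronglyMeasurable_const
  rw [integral_eq_lintegral_of_nonneg_ae (ae_of_all _ fun ω => sq_nonneg _)
    ((G.continuous.comp_aestronglyMeasurable hum).norm.pow 2)]
  refine ENNReal.toReal_le_of_le_ofReal hB0 ?_
  have hterm j : ∫⁻ ω, ENNReal.ofReal (⟪φ j, u ω⟫_ℝ ^ 2 / (lam j + ε) ^ 2) ∂P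
      = ENNReal.ofReal (lam j / (lam j + ε) ^ 2) := by
    rw [← ofReal_integral_eq_lintegral_ofReal
      ((integrable_inner_centered_sq hz hC (φ j)).div_const _)
      (ae_of_all _ fun ω => by positivity), integral_div, integral_inner_centered_sq hz hC,
      h.inner_map, real_inner_self_eq_norm_sq, h.orthonormal.1 j]
    simp
  have hmeas j :
      AEMeasurable (fun ω => ENNReal.ofReal (⟪φ j, u ω⟫_ℝ ^ 2 / (lam j + ε) ^ 2)) P :=
    (((hum.const_inner (c := φ j)).aemeasurable.pow_const 2).div_const _).ennreal_ofReal
  calc ∫⁻ ω, ENNReal.ofReal (‖G (u ω)‖ ^ 2) ∂P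
      = ∫⁻ ω, ∑' j, ENNReal.ofReal (⟪φ j, u ω⟫_ℝ ^ 2 / (lam j + ε) ^ 2) ∂P := by
        refine lintegral_congr_ae ?_
        filter_upwards [ae_sub_integral_mem_ker_orthogonal hz hC] with ω hω
        have h1 := h.hasSum_norm_ringInverse_sq hlam hε hω
        rw [← h1.tsum_eq, ENNReal.ofReal_tsum_of_nonneg (fun j => by positivity) h1.summable]
    _ = ∑' j, ENNReal.ofReal (lam j / (lam j + ε) ^ 2) := by
        rw [lintegral_tsum hmeas]
        simp_rw [hterm]
    _ ≤ ENNReal.ofReal B := by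
        refine ENNReal.tsum_le_of_sum_range_le fun n => ?_
        rw [← ENNReal.ofReal_sum_of_nonneg fun j _ => div_nonneg (hlam j).le (sq_nonneg _)]
        exact ENNReal.ofReal_le_ofReal (hB n)

end EffectiveDimension

/-! ### Eigenvalue sums under polynomial decay -/

section Series

/-- Comparison with the integral of `x ^ (-α)`. -/
theorem sum_range_rpow_neg_le {α : ℝ} (hα : 1 < α) {N : ℕ} (hN : 0 < N) (m : ℕ) :
    ∑ i ∈ Finset.range m, (((N + i : ℕ) : ℝ) + 1) ^ (-α) ≤ (N : ℝ) ^ (1 - α) / (α - 1) := by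
  have hN' : (0 : ℝ) < N := by exact_mod_cast hN
  have hanti : AntitoneOn (fun x : ℝ => x ^ (-α)) (Set.Icc (N : ℝ) (N + m)) := fun x hx y _ hxy =>
    Real.rpow_le_rpow_of_nonpos (hN'.trans_le hx.1) hxy (by linarith)
  have h1 := hanti.sum_le_integral
  have h0 : (0 : ℝ) ∉ Set.uIcc (N : ℝ) (N + m) := by
    rw [Set.uIcc_of_le (by simp)]
    exact fun h => absurd h.1 (by linarith)
  rw [integral_rpow (Or.inr ⟨by linarith, h0⟩)] at h1
  calc _ = ∑ i ∈ Finset.range m, ((N : ℝ) + ((i + 1 : ℕ) : ℝ)) ^ (-α) := by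
        refine Finset.sum_congr rfl fun i _ => ?_
        push_cast
        rw [add_assoc]
    _ ≤ _ := h1
    _ = ((N : ℝ) ^ (1 - α) - ((N : ℝ) + m) ^ (1 - α)) / (α - 1) := by
        rw [show -α + 1 = -(α - 1) by ring, div_neg, ← neg_div, neg_sub, neg_sub]
    _ ≤ _ := by
        have : 0 ≤ ((N : ℝ) + m) ^ (1 - α) := by positivity
        exact div_le_div_of_nonneg_right (by linarith) (by linarith)

/-- Polynomial decay of the eigenvalues bounds `tr ((Σ + ε)⁻² Σ)` by a multiple of
`ε ^ (-(1 + 1 / α))`. -/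
theorem sum_div_add_sq_le {lam : ℕ → ℝ} {α C ε : ℝ} (hα : 1 < α) (hlam : ∀ j, 0 < lam j)
    (hC0 : 0 < C) (hC : ∀ j : ℕ, lam j ≤ C * ((j : ℝ) + 1) ^ (-α)) (hε : 0 < ε) (hε1 : ε ≤ 1)
    (n : ℕ) :
    ∑ j ∈ Finset.range n, lam j / (lam j + ε) ^ 2
      ≤ (2 + C / (α - 1)) * ε ^ (-(α + 1) / α) := by
  have hα0 : 0 < α := by linarith
  set y := ε ^ (-(1 / α)) with hy
  have hy1 : 1 ≤ y := Real.one_le_rpow_of_pos_of_le_one_of_nonpos hε hε1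
    (by rw [neg_nonpos]; positivity)
  -- the first `N ≈ ε ^ (-1 / α)` terms are bounded by `ε⁻¹`, the others by `λⱼ / ε²`
  set N := ⌈y⌉₊ with hN
  have hyN : y ≤ N := Nat.le_ceil y
  have hN2 : (N : ℝ) ≤ 2 * y := by linarith [Nat.ceil_lt_add_one (zero_le_one.trans hy1)]
  have hNpos : 0 < N := Nat.ceil_pos.2 (by linarith)
  have hnn j : 0 ≤ lam j / (lam j + ε) ^ 2 := div_nonneg (hlam j).le (sq_nonneg _)
  have hsmall j : lam j / (lam j + ε) ^ 2 ≤ ε⁻¹ := by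
    have := hlam j
    rw [div_le_iff₀ (by positivity), le_inv_mul_iff₀ hε]
    nlinarith
  have hlarge j : lam j / (lam j + ε) ^ 2 ≤ C * ε⁻¹ ^ 2 * ((j : ℝ) + 1) ^ (-α) := by
    have hj := hlam j
    calc lam j / (lam j + ε) ^ 2 ≤ lam j / ε ^ 2 := by gcongr; linarith
      _ ≤ C * ((j : ℝ) + 1) ^ (-α) / ε ^ 2 := by gcongr; exact hC j
      _ = _ := by rw [inv_pow]; ring
  have hexp1 : ε⁻¹ * y = ε ^ (-(α + 1) / α) := by
    rw [hy, ← Real.rpow_neg_one, ← Real.rpow_add hε]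
    congr 1
    field_simp
    ring
  have hexp2 : ε⁻¹ ^ 2 * y ^ (1 - α) = ε ^ (-(α + 1) / α) := by
    rw [hy, ← Real.rpow_mul hε.le, ← Real.rpow_natCast, ← Real.rpow_neg_one,
      ← Real.rpow_mul hε.le, ← Real.rpow_add hε]
    congr 1
    push_cast
    field_simp
    ring
  calc ∑ j ∈ Finset.range n, lam j / (lam j + ε) ^ 2
      ≤ ∑ j ∈ Finset.range (N + n), lam j / (lam j + ε) ^ 2 :=
        Finset.sum_le_sum_of_subset_of_nonneg
          (Finset.range_subset_range.2 (Nat.le_add_left n N)) fun j _ _ => hnn j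
    _ = ∑ j ∈ Finset.range N, lam j / (lam j + ε) ^ 2
        + ∑ i ∈ Finset.range n, lam (N + i) / (lam (N + i) + ε) ^ 2 :=
        Finset.sum_range_add _ _ _
    _ ≤ N * ε⁻¹ + C * ε⁻¹ ^ 2 * (y ^ (1 - α) / (α - 1)) := by
        refine add_le_add ?_ ?_
        · simpa using Finset.sum_le_card_nsmul (Finset.range N) _ _ fun j _ => hsmall j
        · refine (Finset.sum_le_sum fun i _ => hlarge (N + i)).trans ?_
          rw [← Finset.mul_sum]
          refine mul_le_mul_of_nonneg_left ((sum_range_rpow_neg_le hα hNpos n).trans ?_)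
            (by positivity)
          refine div_le_div_of_nonneg_right ?_ (by linarith)
          exact Real.rpow_le_rpow_of_nonpos (by linarith) hyN (by linarith)
    _ ≤ 2 * (ε⁻¹ * y) + C / (α - 1) * (ε⁻¹ ^ 2 * y ^ (1 - α)) := by
        refine add_le_add ?_ (le_of_eq (by ring))
        rw [mul_comm (N : ℝ), mul_left_comm]
        gcongr
    _ = _ := by rw [hexp1, hexp2]; ring

end Series

/-! ### Features of a bounded continuous kernel -/

section Feature

variable {𝒳 : Type*} (H : Type*) [NormedAddCommGroup H] [InnerProductSpace ℝ H] [CompleteSpace H]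
  [RKHS ℝ H 𝒳 ℝ]

theorem inner_feature (x y : 𝒳) : ⟪feature H x, feature H y⟫_ℝ = kern H y x := by
  rw [feature, feature, ← RKHS.kernel_inner]
  simp [kern]

variable {H} in
theorem continuous_feature [TopologicalSpace 𝒳] (h : BoundedContinuousKernel H) :
    Continuous (feature H : 𝒳 → H) := by
  have hk := h.2
  rw [continuous_iff_continuousAt]
  intro x
  have hsq : Tendsto (fun y => ‖feature H y - feature H x‖ ^ 2) (𝓝 x) (𝓝 0) := by
    have h1 y : ‖feature H y - feature H x‖ ^ 2
        = kern H y y - 2 * kern H x y + kern H x x := by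
      rw [norm_sub_sq_real, ← real_inner_self_eq_norm_sq, ← real_inner_self_eq_norm_sq,
        inner_feature, inner_feature, inner_feature]
    simp_rw [h1]
    have hc : Continuous fun y => kern H y y - 2 * kern H x y + kern H x x :=
      ((hk.comp (continuous_id.prodMk continuous_id)).sub
        ((hk.comp (continuous_const.prodMk continuous_id)).const_mul 2)).add continuous_const
    convert! hc.tendsto x using 2
    ring
  rw [ContinuousAt, tendsto_iff_norm_sub_tendsto_zero]
  simpa [Real.sqrt_sq] using hsq.sqrt

variable {H} in
theorem exists_norm_feature_le [TopologicalSpace 𝒳] (h : BoundedContinuousKernel H) :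
    ∃ A : ℝ, 0 < A ∧ ∀ x : 𝒳, ‖feature H x‖ ≤ A := by
  obtain ⟨C, hC⟩ := h.1
  refine ⟨√C + 1, by positivity, fun x => ?_⟩
  have h1 : ‖feature H x‖ ^ 2 ≤ C := by
    rw [← real_inner_self_eq_norm_sq, inner_feature]
    exact (le_abs_self _).trans (hC x x)
  linarith [Real.le_sqrt_of_sq_le h1]

end Feature

/-! ### Error decomposition and convergence rate -/

section Perturbation

variable {H₁ H₂ : Type*} [NormedAddCommGroup H₁] [InnerProductSpace ℝ H₁] [CompleteSpace H₁]
  [NormedAddCommGroup H₂] [InnerProductSpace ℝ H₂]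

/-- Error bound for Tikhonov regularization with a perturbed operator `A'` in place of `A`. With
`G = (A + ε)⁻¹` and `G' = (A' + ε)⁻¹`, the error is `(1 + G' (A - A')) (G (B - A' R) - ε G R)`. -/
theorem norm_tikhonov_sub_le {A A' : H₁ →L[ℝ] H₁} (hA : ∀ f, 0 ≤ ⟪A f, f⟫_ℝ)
    (hA' : ∀ f, 0 ≤ ⟪A' f, f⟫_ℝ) (B R : H₂ →L[ℝ] H₁) {ε d a ρ : ℝ} (hε : 0 < ε)
    (hd : ‖A' - A‖ ≤ d)
    (ha : ‖Ring.inverse (A + ε • (1 : H₁ →L[ℝ] H₁)) ∘L (B - A' ∘L R)‖ ≤ a)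
    (hρ : ‖Ring.inverse (A + ε • (1 : H₁ →L[ℝ] H₁)) ∘L R‖ ≤ ρ) :
    ‖tikhonov A' B ε - R‖ ≤ (1 + ε⁻¹ * d) * (a + ε * ρ) := by
  set G := Ring.inverse (A + ε • (1 : H₁ →L[ℝ] H₁)) with hG
  set G' := Ring.inverse (A' + ε • (1 : H₁ →L[ℝ] H₁)) with hG'
  have h1 f : A (G f) + ε • G f = f :=
    DFunLike.congr_fun (Ring.mul_inverse_cancel _ (isUnit_add_smul_one hA hε)) f
  have h2 f : G' (A' f + ε • f) = f :=
    DFunLike.congr_fun (Ring.inverse_mul_cancel _ (isUnit_add_smul_one hA' hε)) f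
  have hid : tikhonov A' B ε - R
      = (1 + G' ∘L (A - A')) ∘L (G ∘L (B - A' ∘L R) - ε • (G ∘L R)) := by
    ext g
    have h3 f : (1 + G' ∘L (A - A')) (G f) = G' f := by
      conv_rhs => rw [← h1 f]
      have : A (G f) + ε • G f = (A' (G f) + ε • G f) + (A - A') (G f) := by
        simp only [sub_apply]; abel
      rw [this, map_add, h2]
      simp
    have h4 : (G ∘L (B - A' ∘L R) - ε • (G ∘L R)) g = G (B g - (A' (R g) + ε • R g)) := by
      simp only [sub_apply, smul_apply, ContinuousLinearMap.comp_apply, map_sub, map_add,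
        map_smul]
      abel
    rw [ContinuousLinearMap.comp_apply, h4, h3, map_sub, h2]
    rfl
  rw [hid]
  refine (ContinuousLinearMap.opNorm_comp_le _ _).trans ?_
  refine mul_le_mul ?_ ?_ (norm_nonneg _) ?_
  · refine (norm_add_le _ _).trans (add_le_add ?_ ?_)
    · exact ContinuousLinearMap.norm_id_le
    · refine (ContinuousLinearMap.opNorm_comp_le _ _).trans ?_
      rw [norm_sub_rev]
      exact mul_le_mul (norm_ringInverse_add_smul_one_le hA' hε) hd (norm_nonneg _)
        (by positivity)
  · refine (norm_sub_le _ _).trans (add_le_add ha ?_)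
    rw [norm_smul, Real.norm_of_nonneg hε.le]
    gcongr
  · have : 0 ≤ d := (norm_nonneg _).trans hd
    positivity

end Perturbation

/-- The product of the bounds on the random and the deterministic factors of the error is of the
order of the convergence rate. -/
theorem mul_le_mul_rate {α β ε M₁ M₂ K : ℝ} (hα : 1 < α) (hε : 0 < ε) (hM₁ : 0 ≤ M₁)
    (hM₂ : 0 ≤ M₂) (hK : 0 ≤ K) {n : ℕ} (hn : 0 < n) :
    (1 + ε⁻¹ * (M₁ * (n : ℝ) ^ (-(1 / 2) : ℝ)))
      * (M₂ * ((n : ℝ) ^ (-(1 / 2) : ℝ) * ε ^ (-(α + 1) / (2 * α)))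
        + ε * (K * ε ^ (min β 1 - 1)))
      ≤ (M₂ + K + M₁ * M₂ + M₁ * K) * rate α β n ε := by
  have hn' : (0 : ℝ) < n := by exact_mod_cast hn
  set r := (n : ℝ) ^ (-(1 / 2) : ℝ) with hr
  set e := ε ^ (-(α + 1) / (2 * α)) with he
  set q := ε ^ (min β 1 - 1) with hq
  have h1 : ε ^ min β 1 = ε * q := by
    rw [hq, Real.rpow_sub_one hε.ne', mul_div_cancel₀ _ hε.ne']
  have h2 : (n : ℝ) ^ (-1 : ℝ) = r * r := by
    rw [hr, ← Real.rpow_add hn']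
    norm_num
  have h3 : ε ^ (-(3 * α + 1) / (2 * α)) = ε⁻¹ * e := by
    rw [he, ← Real.rpow_neg_one, ← Real.rpow_add hε]
    congr 1
    field_simp
    ring
  have hr0 : 0 ≤ r := by positivity
  have he0 : 0 ≤ e := by positivity
  have hq0 : 0 ≤ q := by positivity
  have hi : ε⁻¹ * ε = 1 := inv_mul_cancel₀ hε.ne'
  rw [rate, h1, h2, h3]
  have expand : (1 + ε⁻¹ * (M₁ * r)) * (M₂ * (r * e) + ε * (K * q))
      = M₂ * (r * e) + K * (ε * q) + M₁ * M₂ * (r * r * (ε⁻¹ * e)) + M₁ * K * (r * q) := by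
    linear_combination (M₁ * r * K * q) * hi
  rw [expand]
  set S := r * q + ε * q + r * r * (ε⁻¹ * e) + r * e with hS
  have ha1 : 0 ≤ r * q := by positivity
  have ha2 : 0 ≤ ε * q := by positivity
  have ha3 : 0 ≤ r * r * (ε⁻¹ * e) := by positivity
  have ha4 : 0 ≤ r * e := by positivity
  have b1 : M₂ * (r * e) ≤ M₂ * S := mul_le_mul_of_nonneg_left (by linarith) hM₂
  have b2 : K * (ε * q) ≤ K * S := mul_le_mul_of_nonneg_left (by linarith) hK
  have b3 : M₁ * M₂ * (r * r * (ε⁻¹ * e)) ≤ M₁ * M₂ * S :=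
    mul_le_mul_of_nonneg_left (by linarith) (by positivity)
  have b4 : M₁ * K * (r * q) ≤ M₁ * K * S :=
    mul_le_mul_of_nonneg_left (by linarith) (by positivity)
  linarith

/-- The convergence rate of the regularized regression operator for bounded random elements `a Z`
and `b Z` of arbitrary Hilbert spaces. -/
theorem isBigOp_norm_tikhonov_sub {Ω E H₁ H₂ : Type*} [MeasurableSpace Ω] [MeasurableSpace E]
    {P : Measure Ω} [IsProbabilityMeasure P]
    [NormedAddCommGroup H₁] [InnerProductSpace ℝ H₁] [CompleteSpace H₁]
    [NormedAddCommGroup H₂] [InnerProductSpace ℝ H₂] [CompleteSpace H₂]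
    {Z : Ω → E} {Zs : ℕ → Ω → E}
    (hindep : iIndepFun Zs P) (hident : ∀ i, IdentDistrib (Zs i) Z P P)
    {a : E → H₁} {b : E → H₂} (ha : StronglyMeasurable a) (hb : StronglyMeasurable b)
    {A B : ℝ} (hA0 : 0 < A) (hA : ∀ z, ‖a z‖ ≤ A) (hB0 : 0 < B) (hB : ∀ z, ‖b z‖ ≤ B)
    {S : H₁ →L[ℝ] H₁} (hS : S = crossCov P (fun ω => a (Z ω)) (fun ω => a (Z ω)))
    {R : H₂ →L[ℝ] H₁} (hR : crossCov P (fun ω => a (Z ω)) (fun ω => b (Z ω)) = S ∘L R)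
    (hRker : ∀ g, R g ∈ (LinearMap.ker (S : H₁ →ₗ[ℝ] H₁))ᗮ)
    {lam : ℕ → ℝ} {φ : ℕ → H₁} (heig : IsEigenSystem S lam φ)
    {α β : ℝ} (hα : 1 < α) (hdecay : PolynomialDecay lam α) (hβ : 0 < β)
    {T : H₁ →L[ℝ] H₁} {Q : H₂ →L[ℝ] H₁} (hT : IsSpectralPower lam φ (1 + β) T)
    (hsource : S ∘L R = T ∘L Q)
    {ε : ℕ → ℝ} (hεpos : ∀ n, 0 < ε n) (hε : Tendsto ε atTop (𝓝 0)) :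
    IsBigOp P (fun n ω => ‖tikhonov (empCrossCov n (fun i => a (Zs i ω)) (fun i => a (Zs i ω)))
      (empCrossCov n (fun i => a (Zs i ω)) (fun i => b (Zs i ω))) (ε n) - R‖)
      (fun n => rate α β n (ε n)) := by
  have hZ := (hident 0).aemeasurable_snd
  obtain ⟨c, L, hc0, hL0, hdec⟩ := hdecay
  have hlam j : 0 < lam j :=
    (mul_pos hc0 (Real.rpow_pos_of_pos (by positivity) _)).trans_le (hdec j).1
  have hlamL j : lam j ≤ L := by
    refine (hdec j).2.trans (mul_le_of_le_one_right hL0.le ?_)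
    exact Real.rpow_le_one_of_one_le_of_nonpos (by linarith [Nat.cast_nonneg (α := ℝ) j])
      (by linarith)
  have haZ : AEStronglyMeasurable (fun ω => a (Z ω)) P :=
    ha.aestronglyMeasurable.comp_aemeasurable hZ
  have hbZ : AEStronglyMeasurable (fun ω => b (Z ω)) P :=
    hb.aestronglyMeasurable.comp_aemeasurable hZ
  have hSpos : ∀ f, 0 ≤ ⟪S f, f⟫_ℝ := heig.inner_self_nonneg hlam
  -- the regression residual, which is uncorrelated with `a`
  set w : E → H₂ := fun z => b z - R.adjoint (a z) with hw
  have hwm : StronglyMeasurable w := hb.sub (R.adjoint.continuous.comp_stronglyMeasurable ha)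
  have hwZ : AEStronglyMeasurable (fun ω => w (Z ω)) P :=
    hwm.aestronglyMeasurable.comp_aemeasurable hZ
  set W := B + ‖R‖ * A with hW
  have hW0 : 0 < W := by positivity
  have hwW z : ‖w z‖ ≤ W := by
    refine (norm_sub_le _ _).trans (add_le_add (hB z) ((R.adjoint.le_opNorm _).trans ?_))
    rw [LinearIsometryEquiv.norm_map]
    exact mul_le_mul_of_nonneg_left (hA z) (norm_nonneg _)
  have huncorr : crossCov P (fun ω => a (Z ω)) (fun ω => w (Z ω)) = 0 := by
    rw [crossCov_sub_adjoint R haZ hbZ (fun ω => hA _) (fun ω => hB _), hR, hS, sub_self]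
  set D := 2 + L / (α - 1) with hD
  have hD0 : 0 < D := by
    have : 0 < α - 1 := by linarith
    positivity
  set K := L ^ (β - min β 1) * ‖Q‖ with hK
  have hK0 : 0 ≤ K := by positivity
  intro δ hδ
  -- `s` is so large that each of the four Chebyshev bounds below is at most `δ / 4`
  set V := (2 * A) ^ 2 with hV
  have hV0 : 0 < V := by positivity
  set s := √(4 * (V + D) / δ) with hs
  have hs2 : s ^ 2 = 4 * (V + D) / δ := Real.sq_sqrt (by positivity)
  have hs0 : 0 < s := Real.sqrt_pos.2 (by positivity)
  have hVs : V / s ^ 2 ≤ δ / 4 := by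
    rw [hs2, div_div_eq_mul_div, div_le_div_iff₀ (by positivity) (by positivity)]
    nlinarith
  have hDs : D / s ^ 2 ≤ δ / 4 := by
    rw [hs2, div_div_eq_mul_div, div_le_div_iff₀ (by positivity) (by positivity)]
    nlinarith
  refine ⟨4 * W * s + K + 4 * A * s * (4 * W * s) + 4 * A * s * K, ?_⟩
  filter_upwards [eventually_gt_atTop 0, hε.eventually_le_const one_pos] with n hn hε1
  have hn' : (0 : ℝ) < n := by exact_mod_cast hn
  have he := hεpos n
  set e := ε n
  set G := Ring.inverse (S + e • (1 : H₁ →L[ℝ] H₁)) with hG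
  set r := (n : ℝ) ^ (-(1 / 2) : ℝ) with hr
  have hr0 : 0 < r := by positivity
  have hr2 : n * r ^ 2 = 1 := by
    rw [hr, ← Real.rpow_natCast, ← Real.rpow_mul hn'.le,
      show (-(1 / 2) : ℝ) * (2 : ℕ) = -1 by norm_num, Real.rpow_neg_one, mul_inv_cancel₀ hn'.ne']
  set x := e ^ (-(α + 1) / (2 * α)) with hx
  have hx0 : 0 < x := by positivity
  have hx2 : x ^ 2 = e ^ (-(α + 1) / α) := by
    rw [hx, ← Real.rpow_natCast, ← Real.rpow_mul he.le]
    congr 1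
    push_cast
    field_simp
  -- the covariance operator
  have hP₁ := measure_lt_norm_empCrossCov_sub_le hindep hident ha ha hA hA0 hA hn
    (t := s * r) (V := V) (by positivity) (by
      have hle : ∀ ω, ‖a (Z ω) - ∫ ω', a (Z ω') ∂P‖ ^ 2 ≤ V := fun ω =>
        pow_le_pow_left₀ (norm_nonneg _) (norm_sub_integral_le (fun ω => hA (Z ω)) ω) 2
      simpa using integral_mono_of_nonneg (ae_of_all P fun ω => by positivity)
        (integrable_const V) (ae_of_all P hle))
  rw [← hS, show V / (n * (s * r) ^ 2) = V / s ^ 2 by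
    rw [mul_pow, mul_left_comm, hr2, mul_one]] at hP₁
  -- the regularized noise
  have hGa : StronglyMeasurable fun z => G (a z) := G.continuous.comp_stronglyMeasurable ha
  have hP₂ := measure_lt_norm_empCrossCov_sub_le hindep hident hGa hwm (A := ‖G‖ * A)
    (fun z => (G.le_opNorm _).trans (mul_le_mul_of_nonneg_left (hA z) (norm_nonneg _))) hW0 hwW hn
    (t := s * (r * x)) (V := D * x ^ 2) (by positivity) (by
      have h1 := integral_norm_ringInverse_sq_le haZ (fun ω => hA _) (hS ▸ heig) hlam he
        fun n => sum_div_add_sq_le hα hlam hL0 (fun j => (hdec j).2) he hε1 n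
      rw [← hS, ← hx2] at h1
      rw [G.integral_comp_comm (.of_bound haZ A (ae_of_all _ fun ω => hA _))]
      simp_rw [← map_sub]
      exact h1)
  rw [← comp_crossCov G haZ hwZ (fun ω => hA _)
    (fun ω => hwW _), huncorr, ContinuousLinearMap.comp_zero,
    show D * x ^ 2 / (n * (s * (r * x)) ^ 2) = D / s ^ 2 by
      rw [show n * (s * (r * x)) ^ 2 = n * r ^ 2 * s ^ 2 * x ^ 2 by ring, hr2, one_mul,
        mul_div_mul_right _ _ (by positivity)]] at hP₂
  -- the bias
  have hρ : ‖G ∘L R‖ ≤ K * e ^ (min β 1 - 1) := by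
    refine ContinuousLinearMap.opNorm_le_bound _ (by positivity) fun g => ?_
    have h1 := heig.norm_ringInverse_le_of_source hlam hlamL he hβ hT (hRker g) (s := Q g)
      (DFunLike.congr_fun hsource g)
    refine h1.trans ?_
    calc L ^ (β - min β 1) * e ^ (min β 1 - 1) * ‖Q g‖
        ≤ L ^ (β - min β 1) * e ^ (min β 1 - 1) * (‖Q‖ * ‖g‖) := by
          gcongr
          exact Q.le_opNorm g
      _ = _ := by rw [hK]; ring
  calc _ ≤ _ := measure_mono (fun ω hω => ?_)
    _ ≤ _ := (measure_union_le _ _).trans (add_le_add hP₁ hP₂)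
    _ ≤ ENNReal.ofReal δ := by
        rw [← ENNReal.ofReal_add (by positivity) (by positivity),
          ← ENNReal.ofReal_add (by positivity) (by positivity),
          ← ENNReal.ofReal_add (by positivity) (by positivity)]
        exact ENNReal.ofReal_le_ofReal (by linarith)
  by_contra hcon
  simp only [Set.mem_union, Set.mem_ofPred_eq, not_or, not_lt, sub_zero] at hcon hω
  obtain ⟨hc1, hc2⟩ := hcon
  rw [abs_of_nonneg (norm_nonneg _)] at hω
  refine absurd hω (not_lt.2 ?_)
  have hnoise : ‖G ∘L (empCrossCov n (fun i => a (Zs i ω)) (fun i => b (Zs i ω))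
      - empCrossCov n (fun i => a (Zs i ω)) (fun i => a (Zs i ω)) ∘L R)‖
      ≤ 4 * W * s * (r * x) := by
    rw [← empCrossCov_sub_adjoint, comp_empCrossCov]
    exact hc2.trans_eq (by ring)
  refine (norm_tikhonov_sub_le hSpos (inner_empCrossCov_self_nonneg n _) _ R he
    (hc1.trans_eq (by ring : 4 * A * (s * r) = 4 * A * s * r)) hnoise hρ).trans ?_
  exact mul_le_mul_rate hα he (by positivity) (by positivity) hK0 hn

end GSIR

theorem theorem1
    {Ω : Type*} [MeasurableSpace Ω] (P : Measure Ω) [IsProbabilityMeasure P]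
    {p q : ℕ} (ΩX : Set (EuclideanSpace ℝ (Fin p))) (ΩY : Set (EuclideanSpace ℝ (Fin q)))
    -- the reproducing kernel Hilbert spaces on `ΩX` and `ΩY`
    (HX : Type*) [NormedAddCommGroup HX] [InnerProductSpace ℝ HX] [CompleteSpace HX]
    [RKHS ℝ HX ΩX ℝ]
    (HY : Type*) [NormedAddCommGroup HY] [InnerProductSpace ℝ HY] [CompleteSpace HY]
    [RKHS ℝ HY ΩY ℝ]
    -- the random vectors and the i.i.d. sample
    (X : Ω → ΩX) (Y : Ω → ΩY) (hX : Measurable X) (hY : Measurable Y)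
    (Xs : ℕ → Ω → ΩX) (Ys : ℕ → Ω → ΩY)
    (hindep : iIndepFun (fun (i : ℕ) (ω : Ω) => (Xs i ω, Ys i ω)) P)
    (hident : ∀ i, IdentDistrib (fun ω => (Xs i ω, Ys i ω)) (fun ω => (X ω, Y ω)) P P)
    -- assumptions on the kernels
    (hdenseX : GSIR.DenseModConstants HX P X) (hdenseY : GSIR.DenseModConstants HY P Y)
    (hkernX : GSIR.BoundedContinuousKernel HX) (hkernY : GSIR.BoundedContinuousKernel HY)
    -- the population covariance operators
    (SigmaXX : HX →L[ℝ] HX) (SigmaXY : HY →L[ℝ] HX)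
    (hSigmaXX : SigmaXX = GSIR.crossCov P
      (fun ω => GSIR.feature HX (X ω)) (fun ω => GSIR.feature HX (X ω)))
    (hSigmaXY : SigmaXY = GSIR.crossCov P
      (fun ω => GSIR.feature HX (X ω)) (fun ω => GSIR.feature HY (Y ω)))
    -- the regression operator `R_XY = Σ_XX† Σ_XY` is well defined and bounded
    (hrange : LinearMap.range (SigmaXY : HY →ₗ[ℝ] HX) ≤ LinearMap.range (SigmaXX : HX →ₗ[ℝ] HX))
    (R : HY →L[ℝ] HX) (hR : ∀ g : HY, R g = GSIR.regressionMap SigmaXX SigmaXY hrange g)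
    -- polynomial decay of the eigenvalues of `Σ_XX`
    (lam : ℕ → ℝ) (φ : ℕ → HX) (heig : GSIR.IsEigenSystem SigmaXX lam φ)
    (α : ℝ) (hα : 1 < α) (hdecay : GSIR.PolynomialDecay lam α)
    -- source condition `Σ_XY = Σ_XX ^ (1 + β) S_XY`
    (β : ℝ) (hβ : 0 < β)
    (hsource : ∃ (T : HX →L[ℝ] HX) (S : HY →L[ℝ] HX),
      GSIR.IsSpectralPower lam φ (1 + β) T ∧ SigmaXY = T ∘L S)
    -- the regularization parameters
    (ε : ℕ → ℝ) (hεpos : ∀ n, 0 < ε n) (hε : Tendsto ε atTop (𝓝 0))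
    -- the estimator
    (Rhat : ℕ → Ω → (HY →L[ℝ] HX))
    (hRhat : ∀ n ω, Rhat n ω = GSIR.tikhonov
      (GSIR.empCrossCov n (fun i => GSIR.feature HX (Xs i ω)) (fun i => GSIR.feature HX (Xs i ω)))
      (GSIR.empCrossCov n (fun i => GSIR.feature HX (Xs i ω)) (fun i => GSIR.feature HY (Ys i ω)))
      (ε n)) :
    GSIR.IsBigOp P (fun n ω => ‖Rhat n ω - R‖) (fun n => GSIR.rate α β n (ε n)) := by
  obtain ⟨T, S, hT, hTS⟩ := hsource
  obtain ⟨A, hA0, hA⟩ := GSIR.exists_norm_feature_le hkernX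
  obtain ⟨B, hB0, hB⟩ := GSIR.exists_norm_feature_le hkernY
  have hSR : SigmaXY = SigmaXX ∘L R := by
    ext1 g
    rw [ContinuousLinearMap.comp_apply, hR, GSIR.map_regressionMap]
  have ha : StronglyMeasurable fun z : ΩX × ΩY => GSIR.feature HX z.1 :=
    (GSIR.continuous_feature hkernX).stronglyMeasurable.comp_measurable measurable_fst
  have hb : StronglyMeasurable fun z : ΩX × ΩY => GSIR.feature HY z.2 :=
    (GSIR.continuous_feature hkernY).stronglyMeasurable.comp_measurable measurable_snd
  simp_rw [hRhat]
  exact GSIR.isBigOp_norm_tikhonov_sub hindep hident ha hb hA0 (fun z => hA z.1) hB0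
    (fun z => hB z.2) hSigmaXX (hSigmaXY.symm.trans hSR)
    (fun g => by rw [hR]; exact GSIR.regressionMap_mem_ker_orthogonal _ _ _ g) heig hα hdecay hβ
    hT (hSR.symm.trans hTS) hεpos hε
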